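/- Let $f$ be the random completely multiplicative function: the values $f(p)$, $p$ prime, are independent random variables with $\mathbb{P}(f(p)=1)=\mathbb{P}(f(p)=-1)=\tfrac12$, and $f$ is extended to all positive integers by complete multiplicativity, i.e. $f(1)=1$ and $f(mn)=f(m)f(n)$ for all $m,n\ge 1$. For real $x$ put $$S_x=\sum_{1\le n\le x}\frac{f(n)}{\sqrt n}.$$ Then with probability $1$ the sum $S_x$ changes sign infinitely many times as $x\to\infty$; that is, almost surely, for every $X$ there are real numbers $y>x\ge X$ such that $S_x$ and $S_y$ are nonzero and of opposite signs. -/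

import Mathlib

open MeasureTheory ProbabilityTheory

/-- `f` is a random completely multiplicative function on the probability space `(Ω, μ)`:
the values `f p` at the primes are independent random signs, each equal to `1` or `-1` with
probability `1/2`, and `f` is completely multiplicative on the positive integers.
The value `f 0` plays no role and is left unconstrained. -/
structure IsRandomCompletelyMultiplicative {Ω : Type*} [MeasurableSpace Ω] (μ : Measure Ω)
    (f : ℕ → Ω → ℤ) : Prop where
  map_one : ∀ ω, f 1 ω = 1
  map_mul : ∀ ω, ∀ m n : ℕ, 0 < m → 0 < n → f (m * n) ω = f m ω * f n ω
  measurable_prime : ∀ p : Nat.Primes, Measurable (f p)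
  prob_one : ∀ p : Nat.Primes, μ {ω | f p ω = 1} = 1 / 2
  prob_neg_one : ∀ p : Nat.Primes, μ {ω | f p ω = -1} = 1 / 2
  indep : iIndepFun (fun p : Nat.Primes => f p) μ

/-- The partial sum `S_x = ∑_{1 ≤ n ≤ x} a n / √n`, for real `x`. -/
noncomputable def partialSum (a : ℕ → ℤ) (x : ℝ) : ℝ :=
  ∑ n ∈ Finset.Icc 1 ⌊x⌋₊, (a n : ℝ) / Real.sqrt n

/-- `S x` changes sign infinitely many times as `x → ∞`: beyond every `X` there are two points
at which `S` takes values of (strictly) opposite signs. -/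
def ChangesSignInfinitelyOften (S : ℝ → ℝ) : Prop :=
  ∀ X : ℝ, ∃ x y : ℝ, X ≤ x ∧ x < y ∧ S x * S y < 0

open Filter Topology

/-!
Write `E_s` for the Euler product `∏ p, (1 - f(p) p ^ (-1/2-s))⁻¹`, the value of the Dirichlet
series of `f` at `1/2 + s`. By partial summation `E_s / s = ∫ x in 1..∞, S_x x ^ (-s-1)`. If
`S_x ≤ 0` from some point on, then `E_s / s` is bounded above; if `S_x ≥ 0` from some point on, then
`E_s / s` is, up to a bounded error, decreasing in `s`. So a large value of `E_s / s` together with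
`E_s / s ≥ 8 E_{ls} / (ls)` for some `l < 1` rules out a constant sign.

The quotient `E_s / E_{ls}` is the exponential of a weighted sum of independent random signs of
variance `log (1/l) + O(1)`, minus a drift of about half that size. For a suitable `l` it exceeds
`8/l` with a probability bounded below as `s → 0`, even after discarding the factors of any given
finite set of primes. Hence, conditionally on finitely many values `f(p)`, the event that `S` has
constant sign from `m` on has probability at most `1 - c`, and by Lévy's zero-one law it is null.

To avoid conditionally convergent series, `E_s` is replaced by a product over a finite set of primes
and the Dirichlet series by an Abel mean of finite length; these are close in mean square because
`f(m) f(n)` has mean zero unless `m n` is a square.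
-/

/-- The sequence `S` does not change sign from the index `m` on. -/
def HasConstantSignFrom (S : ℕ → ℝ) (m : ℕ) : Prop :=
  (∀ n, m ≤ n → 0 ≤ S n) ∨ ∀ n, m ≤ n → S n ≤ 0

lemma exists_hasConstantSignFrom_of_not_changesSignInfinitelyOften {S : ℝ → ℝ}
    (h : ¬ ChangesSignInfinitelyOften S) : ∃ m, HasConstantSignFrom (fun n : ℕ => S n) m := by
  unfold ChangesSignInfinitelyOften at h
  push Not at h
  obtain ⟨X, hX⟩ := h
  obtain ⟨m, hm⟩ := exists_nat_ge X
  refine ⟨m, ?_⟩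
  by_contra hc
  simp only [HasConstantSignFrom, not_or, not_forall, not_le] at hc
  obtain ⟨⟨i, hi, hi0⟩, ⟨j, hj, hj0⟩⟩ := hc
  have hneg : S i * S j < 0 := mul_neg_of_neg_of_pos hi0 hj0
  have hle {k : ℕ} (hk : m ≤ k) : X ≤ k := hm.trans (by exact_mod_cast hk)
  rcases lt_trichotomy i j with hij | rfl | hij
  · exact hneg.not_ge (hX i j (hle hi) (by exact_mod_cast hij))
  · exact hi0.not_gt hj0
  · exact hneg.not_ge (mul_comm (S i) (S j) ▸ hX j i (hle hj) (by exact_mod_cast hij))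

lemma sum_Icc_le_sum_Icc_of_nonpos {g h : ℕ → ℝ} {m : ℕ}
    (hg : ∀ n, 0 < n → m ≤ n → g n ≤ 0) (hgh : ∀ n, 0 < n → g n ≤ h n) (hh : ∀ n, 0 ≤ h n) (N : ℕ) :
    ∑ n ∈ Finset.Icc 1 N, g n ≤ ∑ n ∈ Finset.Icc 1 m, h n := by
  calc ∑ n ∈ Finset.Icc 1 N, g n
      ≤ ∑ n ∈ Finset.Icc 1 N, if n ≤ m then h n else 0 := by
        refine Finset.sum_le_sum fun n hn => ?_
        split_ifs with hnm
        · exact hgh n (Finset.mem_Icc.1 hn).1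
        · exact hg n (Finset.mem_Icc.1 hn).1 (not_le.1 hnm).le
    _ = ∑ n ∈ Finset.Icc 1 N with n ≤ m, h n := (Finset.sum_filter _ _).symm
    _ ≤ ∑ n ∈ Finset.Icc 1 m, h n := by
        refine Finset.sum_le_sum_of_subset_of_nonneg (fun n hn => ?_) fun n _ _ => hh n
        simp only [Finset.mem_filter, Finset.mem_Icc] at hn ⊢
        exact ⟨hn.1.1, hn.2⟩

lemma HasConstantSignFrom.sum_mul_le {S u v : ℕ → ℝ} {m N : ℕ} (hS : HasConstantSignFrom S m)
    (hu : ∀ n, 0 < n → 0 ≤ u n) (huv : ∀ n, 0 < n → u n ≤ v n) (hv : ∀ n, 0 < n → v n ≤ 1)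
    (h : 2 * ∑ n ∈ Finset.Icc 1 N, S n * v n ≤ ∑ n ∈ Finset.Icc 1 N, S n * u n) :
    ∑ n ∈ Finset.Icc 1 N, S n * u n ≤ 2 * ∑ n ∈ Finset.Icc 1 m, |S n| := by
  have habs {x r : ℝ} (hr : |r| ≤ 1) : x * r ≤ |x| :=
    (le_abs_self _).trans ((abs_mul x r).trans_le (mul_le_of_le_one_right (abs_nonneg x) hr))
  rcases hS with hpos | hneg
  · have hdiff := sum_Icc_le_sum_Icc_of_nonpos (g := fun n => S n * (u n - v n))
      (h := fun n => |S n|) (m := m)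
      (fun n h0 hn => mul_nonpos_of_nonneg_of_nonpos (hpos n hn) (sub_nonpos.2 (huv n h0)))
      (fun n h0 => habs (abs_le.2 ⟨by linarith [hu n h0, hv n h0], by linarith [huv n h0]⟩))
      (fun n => abs_nonneg _) N
    simp only [mul_sub, Finset.sum_sub_distrib] at hdiff
    linarith
  · have hle := sum_Icc_le_sum_Icc_of_nonpos (g := fun n => S n * u n)
      (h := fun n => |S n|) (m := m)
      (fun n h0 hn => mul_nonpos_of_nonpos_of_nonneg (hneg n hn) (hu n h0))
      (fun n h0 => habs (abs_le.2 ⟨by linarith [hu n h0], (huv n h0).trans (hv n h0)⟩))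
      (fun n => abs_nonneg _) N
    linarith [Finset.sum_nonneg fun n (_ : n ∈ Finset.Icc 1 m) => abs_nonneg (S n)]

/-- The Dirichlet weight `n ^ (-(1/2 + s))`: the parameter `s` is the distance to the critical
line, and `0` has weight zero unless `s = -1/2`. -/
noncomputable def dirichletWeight (s : ℝ) (n : ℕ) : ℝ := (n : ℝ) ^ (-(1 / 2 + s))

/-- The kernel `∫ x in n..n+1, x ^ (-s-1)`, whose pairing with the partial sums of a Dirichlet
series gives its Abel means. -/
noncomputable def abelKernel (s : ℝ) (n : ℕ) : ℝ := ∫ x in (n : ℝ)..(n + 1 : ℕ), x ^ (-s - 1)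

/-- The weights `1 - (n / (N + 1)) ^ s` of an Abel mean. -/
noncomputable def abelWeight (s : ℝ) (N n : ℕ) : ℝ := 1 - ((n : ℝ) / (N + 1)) ^ s

/-- The Abel mean of the Dirichlet series of `a` at `1/2 + s`, over the integers up to `N`. -/
noncomputable def abelSum (a : ℕ → ℤ) (s : ℝ) (N : ℕ) : ℝ :=
  ∑ n ∈ Finset.Icc 1 N, a n * (dirichletWeight s n * abelWeight s N n)

section AbelKernel

variable {s t : ℝ} {n : ℕ}

lemma intervalIntegrable_rpow_natCast_succ (hn : 0 < n) (r : ℝ) :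
    IntervalIntegrable (fun x : ℝ => x ^ r) volume n (n + 1 : ℕ) := by
  refine intervalIntegral.intervalIntegrable_rpow (Or.inr ?_)
  rw [Set.uIcc_of_le (by push_cast; linarith)]
  exact fun h => h.1.not_gt (Nat.cast_pos.2 hn)

lemma abelKernel_nonneg : 0 ≤ abelKernel s n :=
  intervalIntegral.integral_nonneg (by push_cast; linarith)
    fun _ hx => Real.rpow_nonneg (n.cast_nonneg.trans hx.1) _

lemma abelKernel_le_abelKernel (hn : 0 < n) (hts : t ≤ s) : abelKernel s n ≤ abelKernel t n := by
  refine intervalIntegral.integral_mono_on (by push_cast; linarith)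
    (intervalIntegrable_rpow_natCast_succ hn _) (intervalIntegrable_rpow_natCast_succ hn _)
    fun x hx => ?_
  exact Real.rpow_le_rpow_of_exponent_le ((Nat.one_le_cast.2 hn).trans hx.1) (by linarith)

lemma abelKernel_le_one (hn : 0 < n) (hs : -1 ≤ s) : abelKernel s n ≤ 1 := by
  refine (abelKernel_le_abelKernel hn hs).trans_eq ?_
  simp [abelKernel]

lemma mul_abelKernel (hn : 0 < n) (hs : s ≠ 0) :
    s * abelKernel s n = (n : ℝ) ^ (-s) - ((n + 1 : ℕ) : ℝ) ^ (-s) := by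
  have h0 : (0 : ℝ) ∉ Set.uIcc (n : ℝ) ((n + 1 : ℕ) : ℝ) := by
    rw [Set.uIcc_of_le (by push_cast; linarith)]
    exact fun h => h.1.not_gt (Nat.cast_pos.2 hn)
  rw [abelKernel, integral_rpow (Or.inr ⟨by simpa using hs, h0⟩), sub_add_cancel]
  field_simp
  ring

end AbelKernel

lemma sum_mul_sub_eq_sum_partialSums_mul_sub {R : Type*} [CommRing R] (x y : ℕ → R) (N : ℕ) :
    ∑ n ∈ Finset.Icc 1 N, x n * (y n - y (N + 1)) =
      ∑ n ∈ Finset.Icc 1 N, (∑ k ∈ Finset.Icc 1 n, x k) * (y n - y (n + 1)) := by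
  induction N with
  | zero => simp
  | succ N ih =>
    rw [Finset.sum_Icc_succ_top (by omega) (fun n => (∑ k ∈ Finset.Icc 1 n, x k) *
      (y n - y (n + 1))), ← ih, Finset.sum_Icc_succ_top (by omega),
      Finset.sum_Icc_succ_top (by omega) x, add_mul, Finset.sum_mul, ← add_assoc,
      ← Finset.sum_add_distrib]
    congr 1
    exact Finset.sum_congr rfl fun n _ => by ring

lemma dirichletWeight_mul_abelWeight {n : ℕ} (hn : 0 < n) (s : ℝ) (N : ℕ) :
    dirichletWeight s n * abelWeight s N n =
      (Real.sqrt n)⁻¹ * ((n : ℝ) ^ (-s) - ((N + 1 : ℕ) : ℝ) ^ (-s)) := by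
  have hn : (0 : ℝ) < n := Nat.cast_pos.2 hn
  have hsplit : dirichletWeight s n = (Real.sqrt n)⁻¹ * (n : ℝ) ^ (-s) := by
    rw [dirichletWeight, Real.sqrt_eq_rpow, ← Real.rpow_neg hn.le, ← Real.rpow_add hn, neg_add]
  have hcancel : (n : ℝ) ^ (-s) * ((n : ℝ) / (N + 1)) ^ s = ((N + 1 : ℕ) : ℝ) ^ (-s) := by
    have hne : (n : ℝ) ^ s ≠ 0 := (Real.rpow_pos_of_pos hn s).ne'
    push_cast
    rw [Real.div_rpow hn.le (by positivity), Real.rpow_neg hn.le, Real.rpow_neg (by positivity)]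
    field_simp
  rw [hsplit, abelWeight, mul_assoc, mul_sub, mul_one, hcancel]

lemma abelSum_eq_mul_sum_partialSum_mul_abelKernel (a : ℕ → ℤ) {s : ℝ} (hs : s ≠ 0) (N : ℕ) :
    abelSum a s N = s * ∑ n ∈ Finset.Icc 1 N, partialSum a n * abelKernel s n := by
  calc abelSum a s N
      = ∑ n ∈ Finset.Icc 1 N, (a n : ℝ) / Real.sqrt n *
          ((n : ℝ) ^ (-s) - ((N + 1 : ℕ) : ℝ) ^ (-s)) := by
        refine Finset.sum_congr rfl fun n hn => ?_
        rw [dirichletWeight_mul_abelWeight (Finset.mem_Icc.1 hn).1]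
        ring
    _ = ∑ n ∈ Finset.Icc 1 N, (∑ k ∈ Finset.Icc 1 n, (a k : ℝ) / Real.sqrt k) *
          ((n : ℝ) ^ (-s) - ((n + 1 : ℕ) : ℝ) ^ (-s)) :=
        sum_mul_sub_eq_sum_partialSums_mul_sub _ (fun n : ℕ => (n : ℝ) ^ (-s)) N
    _ = s * ∑ n ∈ Finset.Icc 1 N, partialSum a n * abelKernel s n := by
        rw [Finset.mul_sum]
        refine Finset.sum_congr rfl fun n hn => ?_
        rw [← mul_abelKernel (Finset.mem_Icc.1 hn).1 hs, partialSum, Nat.floor_natCast]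
        ring

lemma tendsto_abelWeight {s : ℝ} (hs : 0 < s) (n : ℕ) :
    Tendsto (fun N => abelWeight s N n) atTop (𝓝 1) := by
  have hquot : Tendsto (fun N : ℕ => (n : ℝ) / (N + 1)) atTop (𝓝 0) :=
    tendsto_const_nhds.div_atTop (tendsto_natCast_atTop_atTop.atTop_add tendsto_const_nhds)
  have hpow := hquot.rpow_const (p := s) (Or.inr hs.le)
  rw [Real.zero_rpow hs.ne'] at hpow
  simpa [abelWeight] using tendsto_const_nhds.sub hpow

lemma abelWeight_mem_Icc {s : ℝ} (hs : 0 ≤ s) {N n : ℕ} (h : n ≤ N) :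
    abelWeight s N n ∈ Set.Icc 0 1 := by
  have hquot : (n : ℝ) / (N + 1) ≤ 1 :=
    div_le_one_of_le₀ (by exact_mod_cast h.trans N.le_succ) (by positivity)
  exact ⟨sub_nonneg.2 (Real.rpow_le_one (by positivity) hquot hs),
    sub_le_self _ (by positivity)⟩

section DirichletWeight

variable {n : ℕ} {s t : ℝ}

lemma dirichletWeight_nonneg (s : ℝ) (n : ℕ) : 0 ≤ dirichletWeight s n :=
  Real.rpow_nonneg n.cast_nonneg _

lemma dirichletWeight_le_dirichletWeight (hn : 0 < n) (h : s ≤ t) :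
    dirichletWeight t n ≤ dirichletWeight s n :=
  Real.rpow_le_rpow_of_exponent_le (Nat.one_le_cast.2 hn) (by linarith)

lemma dirichletWeight_lt_one (hn : 1 < n) (hs : 0 ≤ s) : dirichletWeight s n < 1 :=
  Real.rpow_lt_one_of_one_lt_of_neg (Nat.one_lt_cast.2 hn) (by linarith)

lemma continuous_dirichletWeight (hn : 0 < n) : Continuous fun s => dirichletWeight s n :=
  continuous_const.rpow (by fun_prop) fun _ => Or.inl (Nat.cast_ne_zero.2 hn.ne')

lemma dirichletWeight_mul_dirichletWeight (hn : 0 < n) (s t : ℝ) :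
    dirichletWeight s n * dirichletWeight t n = (n : ℝ) ^ (-(1 + (s + t))) := by
  rw [dirichletWeight, dirichletWeight, ← Real.rpow_add (Nat.cast_pos.2 hn)]
  ring_nf

end DirichletWeight

section PrimeZeta

/-- The prime zeta function `∑ p, p ^ (-x)`, meaningful for `1 < x`. -/
noncomputable def primeZeta (x : ℝ) : ℝ := ∑' p : Nat.Primes, (p : ℝ) ^ (-x)

variable {x : ℝ}

lemma hasSum_primeZeta (hx : 1 < x) : HasSum (fun p : Nat.Primes => (p : ℝ) ^ (-x)) (primeZeta x) :=
  (Nat.Primes.summable_rpow.2 (by linarith)).hasSum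

lemma hasSum_neg_log_one_sub_primes_rpow (hx : 1 < x) :
    HasSum (fun p : Nat.Primes => -Real.log (1 - (p : ℝ) ^ (-x)))
      (Real.log (∑' n : ℕ, 1 / (n : ℝ) ^ x)) := by
  have hlt (p : Nat.Primes) : (p : ℝ) ^ (-x) < 1 :=
    Real.rpow_lt_one_of_one_lt_of_neg (Nat.one_lt_cast.2 p.2.one_lt) (by linarith)
  have hsum : Summable fun p : Nat.Primes => -Real.log (1 - (p : ℝ) ^ (-x)) := by
    simpa only [sub_eq_add_neg] using
      (Real.summable_log_one_add_of_summable (hasSum_primeZeta hx).summable.neg).neg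
  let g : ℕ →*₀ ℝ :=
    { toFun := fun n => (n : ℝ) ^ (-x)
      map_zero' := by rw [Nat.cast_zero, Real.zero_rpow (by linarith)]
      map_one' := by rw [Nat.cast_one, Real.one_rpow]
      map_mul' := fun m n => by
        rw [Nat.cast_mul, Real.mul_rpow (Nat.cast_nonneg _) (Nat.cast_nonneg _)] }
  have hg : Summable fun n => ‖g n‖ := (Real.summable_nat_rpow.2 (by linarith)).norm
  have heuler := EulerProduct.eulerProduct_completely_multiplicative_tprod hg
  have hzeta : ∑' n : ℕ, 1 / (n : ℝ) ^ x = ∑' n, g n :=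
    tsum_congr fun n => by
      change _ = (n : ℝ) ^ (-x)
      rw [Real.rpow_neg n.cast_nonneg, one_div]
  convert hsum.hasSum
  simp only [← Real.log_inv] at hsum ⊢
  rw [hzeta, ← heuler, ← Real.log_exp (∑' _, _),
    Real.rexp_tsum_eq_tprod (fun p => inv_pos.2 (sub_pos.2 (hlt p))) hsum]
  rfl

lemma neg_log_one_sub_le {t : ℝ} (h0 : 0 ≤ t) (h1 : t ≤ 1 / 2) :
    -Real.log (1 - t) ≤ t + 2 * t ^ 2 := by
  have hlog := Real.one_sub_inv_le_log_of_pos (show 0 < 1 - t by linarith)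
  have hinv : (1 - t)⁻¹ ≤ 1 + t + 2 * t ^ 2 := by
    rw [inv_le_iff_one_le_mul₀ (by linarith)]
    nlinarith [mul_nonneg (mul_nonneg h0 h0) (sub_nonneg.2 h1)]
  linarith

lemma primeZeta_le_log_tsum (hx : 1 < x) :
    primeZeta x ≤ Real.log (∑' n : ℕ, 1 / (n : ℝ) ^ x) := by
  refine hasSum_le (fun p => ?_) (hasSum_primeZeta hx) (hasSum_neg_log_one_sub_primes_rpow hx)
  have hlt : (p : ℝ) ^ (-x) < 1 :=
    Real.rpow_lt_one_of_one_lt_of_neg (Nat.one_lt_cast.2 p.2.one_lt) (by linarith)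
  linarith [Real.log_le_sub_one_of_pos (sub_pos.2 hlt)]

lemma log_tsum_le_primeZeta_add (hx : 1 < x) :
    Real.log (∑' n : ℕ, 1 / (n : ℝ) ^ x) ≤ primeZeta x + 2 * primeZeta 2 := by
  refine hasSum_le (fun p => ?_) (hasSum_neg_log_one_sub_primes_rpow hx)
    ((hasSum_primeZeta hx).add ((hasSum_primeZeta one_lt_two).mul_left 2))
  have hp : (1 : ℝ) ≤ p := Nat.one_le_cast.2 p.2.one_le
  have hhalf : (p : ℝ) ^ (-x) ≤ 1 / 2 :=
    calc (p : ℝ) ^ (-x) ≤ (p : ℝ) ^ (-1 : ℝ) := Real.rpow_le_rpow_of_exponent_le hp (by linarith)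
      _ ≤ 1 / 2 := by
        rw [Real.rpow_neg_one, one_div]
        exact inv_anti₀ two_pos (by exact_mod_cast p.2.two_le)
  have hsq : ((p : ℝ) ^ (-x)) ^ 2 ≤ (p : ℝ) ^ (-2 : ℝ) := by
    rw [← Real.rpow_natCast, ← Real.rpow_mul (by positivity)]
    exact Real.rpow_le_rpow_of_exponent_le hp (by push_cast; linarith)
  linarith [neg_log_one_sub_le (by positivity) hhalf]

lemma tendsto_log_mul_tsum_one_div_rpow :
    Tendsto (fun x : ℝ => Real.log (x * ∑' n : ℕ, 1 / (n : ℝ) ^ (1 + x))) (𝓝[>] 0) (𝓝 0) := by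
  have hshift : Tendsto (fun x : ℝ => 1 + x) (𝓝[>] 0) (𝓝[>] 1) := by
    simpa using tendsto_map (f := fun x : ℝ => 1 + x) (x := 𝓝[>] 0)
  have hres := tendsto_sub_mul_tsum_nat_rpow.comp hshift
  simpa [Function.comp_def] using hres.log one_ne_zero

lemma exists_abs_primeZeta_one_add_add_log_le :
    ∃ C, ∀ᶠ x in 𝓝[>] (0 : ℝ), |primeZeta (1 + x) + Real.log x| ≤ C := by
  refine ⟨2 * primeZeta 2 + 1, ?_⟩
  filter_upwards [Metric.tendsto_nhds.1 tendsto_log_mul_tsum_one_div_rpow 1 one_pos,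
    self_mem_nhdsWithin] with x hdist hx
  have hx : 0 < x := hx
  have hx1 : 1 < 1 + x := by linarith
  have hlow := primeZeta_le_log_tsum hx1
  have hupp := log_tsum_le_primeZeta_add hx1
  have hzeta : 1 ≤ ∑' n : ℕ, 1 / (n : ℝ) ^ (1 + x) := by
    simpa using (Real.summable_one_div_nat_rpow.2 hx1).le_tsum 1 fun n _ => by positivity
  rw [Real.dist_eq, sub_zero, Real.log_mul hx.ne' (by linarith), abs_lt] at hdist
  have : 0 ≤ primeZeta 2 := tsum_nonneg fun p => by positivity
  rw [abs_le]
  constructor <;> linarith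

end PrimeZeta

section PrimeSums

variable {s t : ℝ}

lemma hasSum_dirichletWeight_mul_dirichletWeight (h : 0 < s + t) :
    HasSum (fun p : Nat.Primes => dirichletWeight s p * dirichletWeight t p)
      (primeZeta (1 + (s + t))) :=
  (hasSum_primeZeta (by linarith)).congr_fun fun p =>
    dirichletWeight_mul_dirichletWeight p.2.pos s t

lemma hasSum_sq_dirichletWeight_sub (hs : 0 < s) (ht : 0 < t) :
    HasSum (fun p : Nat.Primes => (dirichletWeight t p - dirichletWeight s p) ^ 2)
      (primeZeta (1 + (t + t)) - 2 * primeZeta (1 + (s + t)) + primeZeta (1 + (s + s))) := by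
  have h := ((hasSum_dirichletWeight_mul_dirichletWeight (add_pos ht ht)).sub
    ((hasSum_dirichletWeight_mul_dirichletWeight (add_pos hs ht)).mul_left 2)).add
    (hasSum_dirichletWeight_mul_dirichletWeight (add_pos hs hs))
  exact h.congr_fun fun p => by ring

lemma hasSum_dirichletWeight_sq_sub_sq (hs : 0 < s) (ht : 0 < t) :
    HasSum (fun p : Nat.Primes => dirichletWeight t p ^ 2 - dirichletWeight s p ^ 2)
      (primeZeta (1 + (t + t)) - primeZeta (1 + (s + s))) := by
  have h := (hasSum_dirichletWeight_mul_dirichletWeight (add_pos ht ht)).sub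
    (hasSum_dirichletWeight_mul_dirichletWeight (add_pos hs hs))
  simpa only [sq] using h

lemma tendsto_const_mul_nhdsGT_zero {k : ℝ} (hk : 0 < k) :
    Tendsto (fun s : ℝ => k * s) (𝓝[>] 0) (𝓝[>] 0) := by
  refine tendsto_nhdsWithin_iff.2 ⟨?_, ?_⟩
  · simpa using ((continuous_const_mul k).tendsto 0).mono_left nhdsWithin_le_nhds
  · filter_upwards [self_mem_nhdsWithin] with s hs using mul_pos hk hs

lemma exists_primeZeta_combinations_add_log_le :
    ∃ C, ∀ l : ℝ, 0 < l → l < 1 → ∀ᶠ s in 𝓝[>] (0 : ℝ),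
    |primeZeta (1 + (l * s + l * s)) - 2 * primeZeta (1 + (s + l * s)) + primeZeta (1 + (s + s))
      + Real.log l| ≤ C ∧
    primeZeta (1 + (l * s + l * s)) - primeZeta (1 + (s + s)) + Real.log l ≤ C := by
  obtain ⟨C, hC⟩ := exists_abs_primeZeta_one_add_add_log_le
  refine ⟨4 * C + 2 * Real.log 2, fun l hl0 hl1 => ?_⟩
  have hasymp (k : ℝ) (hk : 0 < k) :
      ∀ᶠ s in 𝓝[>] (0 : ℝ), |primeZeta (1 + k * s) + (Real.log k + Real.log s)| ≤ C := by
    filter_upwards [(tendsto_const_mul_nhdsGT_zero hk).eventually hC, self_mem_nhdsWithin]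
      with s h hs
    rwa [Real.log_mul hk.ne' (ne_of_gt hs)] at h
  filter_upwards [hasymp 2 two_pos, hasymp (1 + l) (by linarith), hasymp (2 * l) (by linarith)]
    with s h1 h2 h3
  rw [Real.log_mul two_ne_zero hl0.ne'] at h3
  rw [← two_mul, ← two_mul, ← one_add_mul, ← mul_assoc]
  have hlog2 : Real.log (1 + l) ≤ Real.log 2 := Real.log_le_log (by linarith) (by linarith)
  have hlog0 : 0 ≤ Real.log (1 + l) := Real.log_nonneg (by linarith)
  rw [abs_le] at h1 h2 h3 ⊢
  refine ⟨⟨?_, ?_⟩, ?_⟩ <;> linarith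

lemma exists_sum_primes_sdiff_bounds : ∃ C, ∀ l : ℝ, 0 < l → l < 1 →
    ∀ B₀ : Finset Nat.Primes, ∀ᶠ s in 𝓝[>] (0 : ℝ), ∀ᶠ B in atTop,
      |∑ p ∈ B \ B₀, (dirichletWeight (l * s) p - dirichletWeight s p) ^ 2 + Real.log l| ≤ C ∧
      ∑ p ∈ B \ B₀, (dirichletWeight (l * s) p ^ 2 - dirichletWeight s p ^ 2) + Real.log l ≤ C := by
  obtain ⟨C, hC⟩ := exists_primeZeta_combinations_add_log_le
  refine ⟨C + 2, fun l hl0 hl1 B₀ => ?_⟩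
  have hB₀ : ∀ᶠ s in 𝓝[>] (0 : ℝ),
      ∑ p ∈ B₀, (dirichletWeight (l * s) p - dirichletWeight s p) ^ 2 < 1 := by
    have hcont : Continuous fun s =>
        ∑ p ∈ B₀, (dirichletWeight (l * s) p - dirichletWeight s p) ^ 2 := by
      refine continuous_finsetSum _ fun p _ => ?_
      have hp := continuous_dirichletWeight p.2.pos
      exact ((hp.comp (continuous_const_mul l)).sub hp).pow 2
    refine ((hcont.tendsto 0).mono_left nhdsWithin_le_nhds).eventually_lt_const ?_
    simp
  filter_upwards [hC l hl0 hl1, hB₀, self_mem_nhdsWithin] with s ⟨hsq, hdiff⟩ hsB₀ hs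
  have hs : 0 < s := hs
  have hls : 0 < l * s := mul_pos hl0 hs
  have hQ := hasSum_sq_dirichletWeight_sub hs hls
  have hD := hasSum_dirichletWeight_sq_sub_sq hs hls
  filter_upwards [(tendsto_order.1 hQ).1 _ (sub_one_lt _), eventually_ge_atTop B₀] with B hB hsub
  have hsplit := Finset.sum_sdiff (f := fun p : Nat.Primes =>
    (dirichletWeight (l * s) p - dirichletWeight s p) ^ 2) hsub
  have hQle := sum_le_hasSum (B \ B₀) (fun p _ => sq_nonneg _) hQ
  have hDle := sum_le_hasSum (B \ B₀) (fun p _ => sub_nonneg.2 (pow_le_pow_left₀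
    (dirichletWeight_nonneg _ _)
    (dirichletWeight_le_dirichletWeight p.2.pos (mul_le_of_le_one_left hs.le hl1.le)) 2)) hD
  rw [abs_le] at hsq ⊢
  refine ⟨⟨?_, ?_⟩, ?_⟩ <;> linarith

end PrimeSums

/-- `a` is completely multiplicative on the positive integers with values `±1` at the primes: a
realization of a random completely multiplicative function. -/
structure IsSignMultiplicative (a : ℕ → ℤ) : Prop where
  map_one : a 1 = 1
  map_mul : ∀ m n : ℕ, 0 < m → 0 < n → a (m * n) = a m * a n
  prime_eq : ∀ p : Nat.Primes, a p = 1 ∨ a p = -1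

lemma isSignMultiplicative_one : IsSignMultiplicative fun _ => 1 where
  map_one := rfl
  map_mul := fun _ _ _ _ => rfl
  prime_eq := fun _ => Or.inl rfl

/-- The finite Euler product of the Dirichlet series of `a` at `1/2 + s`, over the primes in `B`. -/
noncomputable def eulerProd (a : ℕ → ℤ) (s : ℝ) (B : Finset Nat.Primes) : ℝ :=
  ∏ p ∈ B, (1 - a p * dirichletWeight s p)⁻¹

/-- The coefficient of the sign `a p` in the logarithm of the quotient of the Euler products of `a`
at `1/2 + s` and `1/2 + t`. -/
noncomputable def logRatioCoeff (s t : ℝ) (p : ℕ) : ℝ :=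
  Real.artanh (dirichletWeight s p) - Real.artanh (dirichletWeight t p)

/-- Minus the contribution of `p`, independent of the sign `a p`, to the logarithm of the quotient
of the Euler products of `a` at `1/2 + s` and `1/2 + t`. -/
noncomputable def logRatioDrift (s t : ℝ) (p : ℕ) : ℝ :=
  (Real.log (1 - dirichletWeight s p ^ 2) - Real.log (1 - dirichletWeight t p ^ 2)) / 2

lemma artanh_eq_sub_log_div_two {x : ℝ} (h0 : -1 < x) (h1 : x < 1) :
    Real.artanh x = (Real.log (1 + x) - Real.log (1 - x)) / 2 := by
  rw [Real.artanh_eq_half_log ⟨h0.le, h1.le⟩, Real.log_div (by linarith) (by linarith)]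
  ring

lemma log_one_sub_sign_mul {v x : ℝ} (hv : v = 1 ∨ v = -1) (h0 : -1 < x) (h1 : x < 1) :
    Real.log (1 - v * x) = Real.log (1 - x ^ 2) / 2 - v * Real.artanh x := by
  have hfactor : Real.log (1 - x ^ 2) = Real.log (1 + x) + Real.log (1 - x) := by
    rw [← Real.log_mul (by linarith) (by linarith)]
    ring_nf
  rw [hfactor, artanh_eq_sub_log_div_two h0 h1]
  rcases hv with rfl | rfl
  · rw [one_mul]
    ring
  · rw [neg_one_mul, sub_neg_eq_add]
    ring

section LogRatioBounds

variable {x y : ℝ}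

lemma sub_div_le_log_sub_log (hx : 0 < x) (hy : 0 < y) :
    (y - x) / y ≤ Real.log y - Real.log x := by
  rw [← Real.log_div hy.ne' hx.ne', sub_div, div_self hy.ne', ← inv_div]
  exact Real.one_sub_inv_le_log_of_pos (div_pos hy hx)

lemma log_sub_log_le_sub_div (hx : 0 < x) (hy : 0 < y) :
    Real.log y - Real.log x ≤ (y - x) / x := by
  rw [← Real.log_div hy.ne' hx.ne', sub_div, div_self hx.ne']
  exact Real.log_le_sub_one_of_pos (div_pos hy hx)

lemma le_artanh_sub_artanh (h0 : 0 ≤ x) (hxy : x ≤ y) (h1 : y ≤ 1 / 10) :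
    19 / 20 * (y - x) ≤ Real.artanh y - Real.artanh x := by
  have hplus : 10 / 11 * (y - x) ≤ Real.log (1 + y) - Real.log (1 + x) := by
    refine le_trans ?_ (sub_div_le_log_sub_log (by linarith) (by linarith))
    rw [le_div_iff₀ (by linarith)]
    nlinarith
  have hminus : y - x ≤ Real.log (1 - x) - Real.log (1 - y) := by
    refine le_trans ?_ (sub_div_le_log_sub_log (by linarith) (by linarith))
    rw [le_div_iff₀ (by linarith)]
    nlinarith
  rw [artanh_eq_sub_log_div_two (by linarith) (by linarith),
    artanh_eq_sub_log_div_two (by linarith) (by linarith)]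
  linarith

lemma artanh_sub_artanh_le (h0 : 0 ≤ x) (hxy : x ≤ y) (h1 : y ≤ 1 / 10) :
    Real.artanh y - Real.artanh x ≤ 11 / 10 * (y - x) := by
  have hplus : Real.log (1 + y) - Real.log (1 + x) ≤ y - x := by
    refine (log_sub_log_le_sub_div (by linarith) (by linarith)).trans ?_
    rw [div_le_iff₀ (by linarith)]
    nlinarith
  have hminus : Real.log (1 - x) - Real.log (1 - y) ≤ 10 / 9 * (y - x) := by
    refine (log_sub_log_le_sub_div (by linarith) (by linarith)).trans ?_
    rw [div_le_iff₀ (by linarith)]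
    nlinarith
  rw [artanh_eq_sub_log_div_two (by linarith) (by linarith),
    artanh_eq_sub_log_div_two (by linarith) (by linarith)]
  linarith

lemma log_one_sub_sq_sub_log_le (h0 : 0 ≤ x) (hxy : x ≤ y) (h1 : y ≤ 1 / 10) :
    Real.log (1 - x ^ 2) - Real.log (1 - y ^ 2) ≤ 51 / 50 * (y ^ 2 - x ^ 2) := by
  have hsq : x ^ 2 ≤ y ^ 2 := pow_le_pow_left₀ h0 hxy 2
  have hy : y ^ 2 ≤ 1 / 100 := by nlinarith
  refine (log_sub_log_le_sub_div (by linarith) (by linarith)).trans ?_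
  rw [div_le_iff₀ (by linarith)]
  nlinarith

end LogRatioBounds

section LogRatioSums

variable {s t : ℝ}

lemma dirichletWeight_le_one_div_ten (ht : 0 ≤ t) {p : ℕ} (hp : 100 ≤ p) :
    dirichletWeight t p ≤ 1 / 10 := by
  have hp' : (100 : ℝ) ≤ p := by exact_mod_cast hp
  calc dirichletWeight t p ≤ dirichletWeight 0 p :=
        dirichletWeight_le_dirichletWeight (by omega) ht
    _ = (Real.sqrt p)⁻¹ := by
        rw [dirichletWeight, add_zero, Real.rpow_neg p.cast_nonneg, ← Real.sqrt_eq_rpow]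
    _ ≤ 1 / 10 := by
        rw [one_div]
        exact inv_anti₀ (by norm_num) (Real.le_sqrt_of_sq_le (by linarith))

lemma sq_logRatioCoeff_mem_Icc (ht : 0 ≤ t) (hts : t ≤ s) {p : ℕ} (hp : 100 ≤ p) :
    logRatioCoeff s t p ^ 2 ∈ Set.Icc
      (9 / 10 * (dirichletWeight t p - dirichletWeight s p) ^ 2)
      (5 / 4 * (dirichletWeight t p - dirichletWeight s p) ^ 2) := by
  have h0 := dirichletWeight_nonneg s p
  have hle : dirichletWeight s p ≤ dirichletWeight t p :=
    dirichletWeight_le_dirichletWeight (by omega) hts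
  have h1 := dirichletWeight_le_one_div_ten ht hp
  have hlow := le_artanh_sub_artanh h0 hle h1
  have hupp := artanh_sub_artanh_le h0 hle h1
  rw [logRatioCoeff, ← neg_sq, neg_sub]
  constructor <;> nlinarith [sub_nonneg.2 hle]

lemma abs_logRatioCoeff_le (ht : 0 ≤ t) (hts : t ≤ s) {p : ℕ} (hp : 100 ≤ p) :
    |logRatioCoeff s t p| ≤ 1 / 6 := by
  have h0 := dirichletWeight_nonneg s p
  have hle : dirichletWeight s p ≤ dirichletWeight t p :=
    dirichletWeight_le_dirichletWeight (by omega) hts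
  have h1 := dirichletWeight_le_one_div_ten ht hp
  have hlow := le_artanh_sub_artanh h0 hle h1
  have hupp := artanh_sub_artanh_le h0 hle h1
  rw [logRatioCoeff, abs_sub_comm, abs_of_nonneg (by linarith)]
  linarith

lemma logRatioDrift_le (ht : 0 ≤ t) (hts : t ≤ s) {p : ℕ} (hp : 100 ≤ p) :
    logRatioDrift s t p ≤ 51 / 100 * (dirichletWeight t p ^ 2 - dirichletWeight s p ^ 2) := by
  have h := log_one_sub_sq_sub_log_le (dirichletWeight_nonneg s p)
    (dirichletWeight_le_dirichletWeight (by omega) hts) (dirichletWeight_le_one_div_ten ht hp)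
  rw [logRatioDrift]
  linarith

lemma logRatioCoeff_nonpos (ht : 0 ≤ t) (hts : t ≤ s) (p : Nat.Primes) :
    logRatioCoeff s t p ≤ 0 :=
  sub_nonpos.2 (Real.artanh_le_artanh (by linarith [dirichletWeight_nonneg s p])
    (dirichletWeight_lt_one p.2.one_lt ht) (dirichletWeight_le_dirichletWeight p.2.pos hts))

end LogRatioSums

lemma hasSum_abelSum (a : ℕ → ℤ) (s : ℝ) (N : ℕ) :
    HasSum (fun n => a n * (dirichletWeight s n * Set.indicator (Set.Icc 1 N) (abelWeight s N) n))
      (abelSum a s N) := by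
  have hsum : abelSum a s N = ∑ n ∈ Finset.Icc 1 N,
      a n * (dirichletWeight s n * Set.indicator (Set.Icc 1 N) (abelWeight s N) n) := by
    refine Finset.sum_congr rfl fun n hn => ?_
    rw [Set.indicator_of_mem (Set.mem_Icc.2 (Finset.mem_Icc.1 hn))]
  rw [hsum]
  refine hasSum_sum_of_ne_finset_zero fun n hn => ?_
  have hn' : n ∉ Set.Icc 1 N := mt Finset.mem_Icc.2 hn
  rw [Set.indicator_of_notMem hn', mul_zero, mul_zero]

/-- The positive integers all of whose prime factors lie in `B`. -/
def integersFactoredOver (B : Finset Nat.Primes) : Set ℕ :=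
  Nat.factoredNumbers (B.map ⟨(↑), Nat.Primes.coe_nat_injective⟩)

/-- The weight of `n` in the Abel mean up to `N`, minus the indicator of the integers all of whose
prime factors lie in `B`: the discrepancy between an Abel mean and a finite Euler product. -/
noncomputable def cutoffGap (s : ℝ) (B : Finset Nat.Primes) (N n : ℕ) : ℝ :=
  Set.indicator (Set.Icc 1 N) (abelWeight s N) n -
    Set.indicator (integersFactoredOver B) 1 n

lemma abs_cutoffGap_le_one {s : ℝ} (hs : 0 ≤ s) (B : Finset Nat.Primes) (N n : ℕ) :
    |cutoffGap s B N n| ≤ 1 := by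
  have habel : Set.indicator (Set.Icc 1 N) (abelWeight s N) n ∈ Set.Icc (0 : ℝ) 1 := by
    by_cases hn : n ∈ Set.Icc 1 N
    · rw [Set.indicator_of_mem hn]
      exact abelWeight_mem_Icc hs hn.2
    · rw [Set.indicator_of_notMem hn]
      exact Set.left_mem_Icc.2 zero_le_one
  have hfactored : Set.indicator (integersFactoredOver B) 1 n ∈ Set.Icc (0 : ℝ) 1 :=
    ⟨Set.indicator_nonneg (fun _ _ => zero_le_one) n,
      Set.indicator_le' (fun _ _ => le_rfl) (fun _ _ => zero_le_one) n⟩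
  exact abs_sub_le_iff.2 ⟨by linarith [habel.2, hfactored.1], by linarith [habel.1, hfactored.2]⟩

lemma eventually_mem_integersFactoredOver {n : ℕ} (hn : n ≠ 0) :
    ∀ᶠ B : Finset Nat.Primes in atTop, n ∈ integersFactoredOver B := by
  filter_upwards [eventually_ge_atTop (n.primeFactors.subtype Nat.Prime)] with B hB
  refine Nat.mem_factoredNumbers_of_primeFactors_subset hn fun p hp => ?_
  refine Finset.mem_map.2 ⟨⟨p, Nat.prime_of_mem_primeFactors hp⟩, hB ?_, rfl⟩
  exact Finset.mem_subtype.2 hp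

lemma tendsto_cutoffGap {s : ℝ} (hs : 0 < s) {n : ℕ} (hn : 0 < n) :
    Tendsto (fun x : Finset Nat.Primes × ℕ => cutoffGap s x.1 x.2 n) (atTop ×ˢ atTop) (𝓝 0) := by
  have habel : Tendsto (fun x : Finset Nat.Primes × ℕ => abelWeight s x.2 n - 1)
      (atTop ×ˢ atTop) (𝓝 0) := by
    simpa using ((tendsto_abelWeight hs n).comp tendsto_snd).sub_const 1
  refine habel.congr' ?_
  filter_upwards [(eventually_mem_integersFactoredOver hn.ne').prod_inl _,
    (eventually_ge_atTop n).prod_inr _] with x hB hN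
  rw [cutoffGap, Set.indicator_of_mem hB,
    Set.indicator_of_mem (Set.mem_Icc.2 ⟨hn, hN⟩), Pi.one_apply]

namespace IsSignMultiplicative

variable {a : ℕ → ℤ} (ha : IsSignMultiplicative a) {s t : ℝ}
include ha

lemma cast_prime_eq (p : Nat.Primes) : (a p : ℝ) = 1 ∨ (a p : ℝ) = -1 := by
  exact_mod_cast ha.prime_eq p

lemma eq_one_or_eq_neg_one {n : ℕ} (hn : 0 < n) : a n = 1 ∨ a n = -1 := by
  induction n using Nat.recOnMul with
  | zero => exact absurd hn (lt_irrefl 0)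
  | one => exact Or.inl ha.map_one
  | prime p hp => exact ha.prime_eq ⟨p, hp⟩
  | mul m n ihm ihn =>
    rw [ha.map_mul m n (Nat.pos_of_mul_pos_right hn) (Nat.pos_of_mul_pos_left hn)]
    rcases ihm (Nat.pos_of_mul_pos_right hn) with h | h <;>
      rcases ihn (Nat.pos_of_mul_pos_left hn) with h' | h' <;> simp [h, h']

lemma abs_eq_one {n : ℕ} (hn : 0 < n) : |(a n : ℝ)| = 1 := by
  rcases ha.eq_one_or_eq_neg_one hn with h | h <;> simp [h]

lemma abs_partialSum_le (n : ℕ) : |partialSum a n| ≤ n := by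
  rw [partialSum, Nat.floor_natCast]
  calc |∑ k ∈ Finset.Icc 1 n, (a k : ℝ) / Real.sqrt k|
      ≤ ∑ k ∈ Finset.Icc 1 n, |(a k : ℝ) / Real.sqrt k| := Finset.abs_sum_le_sum_abs _ _
    _ ≤ ∑ k ∈ Finset.Icc 1 n, 1 := by
        refine Finset.sum_le_sum fun k hk => ?_
        have hk := (Finset.mem_Icc.1 hk).1
        rw [abs_div, ha.abs_eq_one hk, abs_of_nonneg (Real.sqrt_nonneg _)]
        exact div_le_one_of_le₀ (Real.one_le_sqrt.2 (Nat.one_le_cast.2 hk)) (Real.sqrt_nonneg _)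
    _ = n := by simp

lemma sum_abs_partialSum_le (m : ℕ) : ∑ n ∈ Finset.Icc 1 m, |partialSum a n| ≤ m ^ 2 := by
  calc ∑ n ∈ Finset.Icc 1 m, |partialSum a n| ≤ ∑ _n ∈ Finset.Icc 1 m, (m : ℝ) :=
        Finset.sum_le_sum fun n hn =>
          (ha.abs_partialSum_le n).trans (Nat.cast_le.2 (Finset.mem_Icc.1 hn).2)
    _ = m ^ 2 := by simp [sq]

lemma one_sub_mul_dirichletWeight_pos (hs : 0 ≤ s) (p : Nat.Primes) :
    0 < 1 - a p * dirichletWeight s p := by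
  have h0 := dirichletWeight_nonneg s p
  have h1 := dirichletWeight_lt_one p.2.one_lt hs
  rcases ha.cast_prime_eq p with h | h <;> rw [h] <;> linarith

lemma eulerProd_pos (hs : 0 ≤ s) (B : Finset Nat.Primes) : 0 < eulerProd a s B :=
  Finset.prod_pos fun p _ => inv_pos.2 (ha.one_sub_mul_dirichletWeight_pos hs p)

lemma hasSum_eulerProd (hs : 0 ≤ s) (B : Finset Nat.Primes) :
    HasSum (fun n => a n * (dirichletWeight s n * Set.indicator (integersFactoredOver B) 1 n))
      (eulerProd a s B) := by
  have hzero : dirichletWeight s 0 = 0 := by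
    rw [dirichletWeight, Nat.cast_zero, Real.zero_rpow (by linarith)]
  let g : ℕ →*₀ ℝ :=
    { toFun := fun n => a n * dirichletWeight s n
      map_zero' := by rw [hzero, mul_zero]
      map_one' := by simp [dirichletWeight, ha.map_one]
      map_mul' := fun m n => by
        rcases Nat.eq_zero_or_pos m with rfl | hm
        · simp [hzero]
        rcases Nat.eq_zero_or_pos n with rfl | hn
        · simp [hzero]
        simp only [dirichletWeight, ha.map_mul m n hm hn, Nat.cast_mul, Int.cast_mul,
          Real.mul_rpow m.cast_nonneg n.cast_nonneg]
        ring }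
  have hlt {p : ℕ} (hp : p.Prime) : ‖(g : ℕ →* ℝ) p‖ < 1 := by
    change ‖(a p : ℝ) * dirichletWeight s p‖ < 1
    rw [norm_mul, Real.norm_eq_abs, ha.abs_eq_one hp.pos, one_mul,
      Real.norm_of_nonneg (dirichletWeight_nonneg s p)]
    exact dirichletWeight_lt_one hp.one_lt hs
  have h := (EulerProduct.summable_and_hasSum_factoredNumbers_prod_filter_prime_geometric
    hlt (B.map ⟨(↑), Nat.Primes.coe_nat_injective⟩)).2
  rw [Finset.filter_true_of_mem fun p hp => ?_, Finset.prod_map] at h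
  · refine (hasSum_subtype_iff_indicator.1 h).congr_fun fun n => ?_
    by_cases hn : n ∈ integersFactoredOver B
    · rw [Set.indicator_of_mem hn, Pi.one_apply, mul_one]
      exact (Set.indicator_of_mem hn g).symm
    · rw [Set.indicator_of_notMem hn, mul_zero, mul_zero]
      exact (Set.indicator_of_notMem hn g).symm
  · obtain ⟨q, -, rfl⟩ := Finset.mem_map.1 hp
    exact q.2

lemma hasSum_cutoffGap (hs : 0 ≤ s) (B : Finset Nat.Primes) (N : ℕ) :
    HasSum (fun n => a n * (dirichletWeight s n * cutoffGap s B N n))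
      (abelSum a s N - eulerProd a s B) :=
  ((hasSum_abelSum a s N).sub (ha.hasSum_eulerProd hs B)).congr_fun fun n => by
    rw [cutoffGap]
    ring

lemma eulerProd_div_eulerProd_eq_exp (hs : 0 ≤ s) (ht : 0 ≤ t) (B : Finset Nat.Primes) :
    eulerProd a s B / eulerProd a t B =
      Real.exp (∑ p ∈ B, logRatioCoeff s t p * a p - ∑ p ∈ B, logRatioDrift s t p) := by
  rw [eulerProd, eulerProd, ← Finset.prod_div_distrib, ← Finset.sum_sub_distrib, Real.exp_sum]
  refine Finset.prod_congr rfl fun p _ => ?_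
  have hpos {r : ℝ} (hr : 0 ≤ r) := ha.one_sub_mul_dirichletWeight_pos hr p
  have hlog {r : ℝ} (hr : 0 ≤ r) := log_one_sub_sign_mul (ha.cast_prime_eq p)
    (by linarith [dirichletWeight_nonneg r p]) (dirichletWeight_lt_one p.2.one_lt hr)
  rw [inv_div_inv, ← Real.exp_log (div_pos (hpos ht) (hpos hs)),
    Real.log_div (hpos ht).ne' (hpos hs).ne', hlog ht, hlog hs, logRatioCoeff, logRatioDrift]
  ring_nf

lemma eulerProd_one_div_le (ht : 0 ≤ t) (hts : t ≤ s) (B : Finset Nat.Primes) :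
    eulerProd (fun _ => 1) s B / eulerProd (fun _ => 1) t B ≤
      eulerProd a s B / eulerProd a t B := by
  rw [ha.eulerProd_div_eulerProd_eq_exp (ht.trans hts) ht,
    isSignMultiplicative_one.eulerProd_div_eulerProd_eq_exp (ht.trans hts) ht]
  refine Real.exp_le_exp.2 (sub_le_sub_right (Finset.sum_le_sum fun p _ => ?_) _)
  refine mul_le_mul_of_nonpos_left ?_ (logRatioCoeff_nonpos ht hts p)
  rcases ha.cast_prime_eq p with h | h <;> norm_num [h]

lemma not_hasConstantSignFrom {l : ℝ} {m N : ℕ} {B : Finset Nat.Primes} (hs : 0 < s) (hl : 0 < l)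
    (hl1 : l ≤ 1) (hlarge : (2 * m ^ 2 + 4) * s ≤ eulerProd a s B)
    (hratio : 8 / l ≤ eulerProd a s B / eulerProd a (l * s) B)
    (herr : |abelSum a s N - eulerProd a s B| ≤ l * s)
    (herr' : |abelSum a (l * s) N - eulerProd a (l * s) B| ≤ l * s) :
    ¬ HasConstantSignFrom (fun n : ℕ => partialSum a n) m := by
  intro hsign
  have hls : 0 < l * s := mul_pos hl hs
  have hlss : l * s ≤ s := mul_le_of_le_one_left hs.le hl1
  have hpairing := abelSum_eq_mul_sum_partialSum_mul_abelKernel a hs.ne' N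
  have hpairing' := abelSum_eq_mul_sum_partialSum_mul_abelKernel a hls.ne' N
  set I := ∑ n ∈ Finset.Icc 1 N, partialSum a n * abelKernel s n
  set I' := ∑ n ∈ Finset.Icc 1 N, partialSum a n * abelKernel (l * s) n
  have hI : 2 * m ^ 2 < I := by
    have : s * (2 * m ^ 2 + 3) ≤ s * I := by linarith [(abs_le.1 herr).1]
    linarith [le_of_mul_le_mul_left this hs]
  have hI' : 2 * I' ≤ I := by
    rw [div_le_div_iff₀ hl (ha.eulerProd_pos hls.le B)] at hratio
    have : l * s * (2 * I') ≤ l * s * I := by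
      nlinarith [(abs_le.1 herr).1, (abs_le.1 herr').2, sq_nonneg (m : ℝ),
        mul_nonneg hl.le (sq_nonneg (m : ℝ))]
    exact le_of_mul_le_mul_left this hls
  have hbound := hsign.sum_mul_le (u := abelKernel s) (v := abelKernel (l * s)) (N := N)
    (fun _ _ => abelKernel_nonneg) (fun n hn => abelKernel_le_abelKernel hn hlss)
    (fun n hn => abelKernel_le_one hn (by linarith)) hI'
  linarith [ha.sum_abs_partialSum_le m]

end IsSignMultiplicative

lemma eulerProd_eq_mul_of_subset (a : ℕ → ℤ) (s : ℝ) {B₀ B : Finset Nat.Primes} (h : B₀ ⊆ B) :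
    eulerProd a s B = eulerProd a s (B \ B₀) * eulerProd a s B₀ :=
  (Finset.prod_sdiff h).symm

lemma mul_le_eulerProd_div {a : ℕ → ℤ} {s t x y : ℝ} {B₀ B : Finset Nat.Primes} (h : B₀ ⊆ B)
    (hx0 : 0 ≤ x) (hy0 : 0 ≤ y) (hx : x ≤ eulerProd a s (B \ B₀) / eulerProd a t (B \ B₀))
    (hy : y ≤ eulerProd a s B₀ / eulerProd a t B₀) :
    x * y ≤ eulerProd a s B / eulerProd a t B := by
  rw [eulerProd_eq_mul_of_subset a s h, eulerProd_eq_mul_of_subset a t h, mul_div_mul_comm]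
  exact mul_le_mul hx hy hy0 (hx0.trans hx)

lemma tendsto_eulerProd_one (B : Finset Nat.Primes) :
    Tendsto (fun s => eulerProd (fun _ => 1) s B) (𝓝[>] 0) (𝓝 (eulerProd (fun _ => 1) 0 B)) := by
  refine tendsto_finsetProd B fun p _ => Tendsto.inv₀ ?_
    (isSignMultiplicative_one.one_sub_mul_dirichletWeight_pos le_rfl p).ne'
  exact ((((continuous_dirichletWeight p.2.pos).tendsto 0).mono_left nhdsWithin_le_nhds).const_mul
    _).const_sub 1

lemma eventually_half_le_eulerProd_div (B : Finset Nat.Primes) {l : ℝ} (hl : 0 < l) (hl1 : l ≤ 1) :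
    ∀ᶠ s in 𝓝[>] (0 : ℝ), ∀ a, IsSignMultiplicative a →
      1 / 2 ≤ eulerProd a s B / eulerProd a (l * s) B := by
  have hpos := isSignMultiplicative_one.eulerProd_pos le_rfl B
  have hlim := (tendsto_eulerProd_one B).div
    ((tendsto_eulerProd_one B).comp (tendsto_const_mul_nhdsGT_zero hl)) hpos.ne'
  rw [div_self hpos.ne'] at hlim
  filter_upwards [hlim.eventually_const_le (by norm_num : (1 / 2 : ℝ) < 1),
    self_mem_nhdsWithin] with s hs hs0 a ha
  exact hs.trans (ha.eulerProd_one_div_le (mul_nonneg hl.le (Set.mem_Ioi.1 hs0).le)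
    (mul_le_of_le_one_left (Set.mem_Ioi.1 hs0).le hl1) B)

/-- A family of independent random signs, each equal to `1` or `-1` with probability `1/2`. -/
structure IsRademacherFamily {Ω ι : Type*} [MeasurableSpace Ω] (μ : Measure Ω)
    (ε : ι → Ω → ℤ) : Prop where
  measurable : ∀ i, Measurable (ε i)
  prob_one : ∀ i, μ {ω | ε i ω = 1} = 1 / 2
  prob_neg_one : ∀ i, μ {ω | ε i ω = -1} = 1 / 2
  indep : iIndepFun ε μ

section Rademacher

variable {Ω ι : Type*} [MeasurableSpace Ω] {μ : Measure Ω}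

lemma setIntegral_le_sqrt_integral_sq_mul [IsFiniteMeasure μ] {g : Ω → ℝ}
    (hg : MemLp g 2 μ) (hg0 : ∀ ω, 0 ≤ g ω) {S : Set Ω} (hS : MeasurableSet S) :
    ∫ ω in S, g ω ∂μ ≤ √((∫ ω, g ω ^ 2 ∂μ) * μ.real S) := by
  have hind : MemLp (S.indicator fun _ => (1 : ℝ)) 2 μ :=
    memLp_indicator_const 2 hS 1 (Or.inr (measure_ne_top μ _))
  have h := integral_mul_le_Lp_mul_Lq_of_nonneg Real.HolderConjugate.two_two
    (ae_of_all μ hg0) (ae_of_all μ fun ω => Set.indicator_nonneg (fun _ _ => zero_le_one) ω)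
    (by simpa using hg) (by simpa using hind)
  have hmul (ω : Ω) : g ω * S.indicator (fun _ => 1) ω = S.indicator g ω := by
    by_cases hω : ω ∈ S <;> simp [hω]
  have hsq (ω : Ω) : S.indicator (fun _ => (1 : ℝ)) ω ^ 2 = S.indicator 1 ω := by
    by_cases hω : ω ∈ S <;> simp [hω]
  simp only [Real.rpow_two, hmul, hsq, integral_indicator_one hS, integral_indicator hS] at h
  rwa [← Real.sqrt_eq_rpow, ← Real.sqrt_eq_rpow,
    ← Real.sqrt_mul (integral_nonneg fun _ => sq_nonneg _)] at h

lemma mgf_le_exp_mul_mgf_add_sqrt [IsFiniteMeasure μ] {X : Ω → ℝ}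
    (hX : Measurable X) {θ θ' y : ℝ} (hθ : θ ≤ θ')
    (hint : Integrable (fun ω => Real.exp (θ * X ω)) μ)
    (hint' : Integrable (fun ω => Real.exp (2 * θ' * X ω)) μ) :
    mgf X μ θ' ≤ Real.exp ((θ' - θ) * y) * mgf X μ θ +
      √(mgf X μ (2 * θ') * μ.real {ω | y ≤ X ω}) := by
  have hmeas : MeasurableSet {ω | y ≤ X ω} := measurableSet_le measurable_const hX
  have hsq (ω : Ω) : Real.exp (θ' * X ω) ^ 2 = Real.exp (2 * θ' * X ω) := by
    rw [← Real.exp_nat_mul]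
    ring_nf
  have hmemLp : MemLp (fun ω => Real.exp (θ' * X ω)) 2 μ :=
    (memLp_two_iff_integrable_sq (by fun_prop)).2 (by simpa only [hsq] using hint')
  have hlarge := setIntegral_le_sqrt_integral_sq_mul hmemLp (fun ω => (Real.exp_pos _).le) hmeas
  have hsmall : ∫ ω in {ω | y ≤ X ω}ᶜ, Real.exp (θ' * X ω) ∂μ ≤
      Real.exp ((θ' - θ) * y) * mgf X μ θ := by
    calc ∫ ω in {ω | y ≤ X ω}ᶜ, Real.exp (θ' * X ω) ∂μ
        ≤ ∫ ω in {ω | y ≤ X ω}ᶜ, Real.exp ((θ' - θ) * y) * Real.exp (θ * X ω) ∂μ := by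
          refine setIntegral_mono_on (hmemLp.integrable one_le_two).integrableOn
            (hint.const_mul _).integrableOn hmeas.compl fun ω hω => ?_
          rw [← Real.exp_add]
          have hlt : X ω < y := not_le.1 hω
          exact Real.exp_le_exp.2 (by nlinarith)
      _ ≤ ∫ ω, Real.exp ((θ' - θ) * y) * Real.exp (θ * X ω) ∂μ :=
          setIntegral_le_integral (hint.const_mul _) (ae_of_all _ fun ω => by positivity)
      _ = Real.exp ((θ' - θ) * y) * mgf X μ θ := integral_const_mul _ _
  simp only [hsq] at hlarge
  rw [mgf, ← integral_add_compl hmeas (hmemLp.integrable one_le_two), add_comm]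
  exact add_le_add hsmall hlarge

variable [IsProbabilityMeasure μ]

namespace IsRademacherFamily

variable {ε : ι → Ω → ℤ} (hε : IsRademacherFamily μ ε)
include hε

lemma ae_eq_one_or_eq_neg_one (i : ι) : ∀ᵐ ω ∂μ, ε i ω = 1 ∨ ε i ω = -1 := by
  have hpos : MeasurableSet {ω | ε i ω = 1} := hε.measurable i (measurableSet_singleton 1)
  have hneg : MeasurableSet {ω | ε i ω = -1} := hε.measurable i (measurableSet_singleton (-1))
  have hdisj : Disjoint {ω | ε i ω = 1} {ω | ε i ω = -1} :=
    Set.disjoint_left.2 fun ω (h : ε i ω = 1) (h' : ε i ω = -1) => by omega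
  refine (mem_ae_iff_prob_eq_one (hpos.union hneg)).2 ?_
  rw [measure_union hdisj hneg, hε.prob_one, hε.prob_neg_one, ENNReal.add_halves]

lemma integral_comp (φ : ℤ → ℝ) (i : ι) : ∫ ω, φ (ε i ω) ∂μ = (φ 1 + φ (-1)) / 2 := by
  have hpos : MeasurableSet {ω | ε i ω = 1} := hε.measurable i (measurableSet_singleton 1)
  have hneg : MeasurableSet {ω | ε i ω = -1} := hε.measurable i (measurableSet_singleton (-1))
  have hae : (fun ω => φ (ε i ω)) =ᵐ[μ] fun ω =>
      {ω | ε i ω = 1}.indicator (fun _ => φ 1) ω +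
        {ω | ε i ω = -1}.indicator (fun _ => φ (-1)) ω := by
    filter_upwards [hε.ae_eq_one_or_eq_neg_one i] with ω hω
    rcases hω with h | h <;> simp [h, Set.indicator]
  rw [integral_congr_ae hae, integral_add ((integrable_const _).indicator hpos)
    ((integrable_const _).indicator hneg), integral_indicator_const _ hpos,
    integral_indicator_const _ hneg, measureReal_def, measureReal_def, hε.prob_one,
    hε.prob_neg_one]
  norm_num
  ring

lemma integral_prod_comp (φ : ι → ℤ → ℝ) (B : Finset ι) :
    ∫ ω, ∏ i ∈ B, φ i (ε i ω) ∂μ = ∏ i ∈ B, (φ i 1 + φ i (-1)) / 2 := by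
  have hB : iIndepFun (fun i : B => ε i) μ := hε.indep.precomp Subtype.val_injective
  have h := hB.integral_fun_prod_comp (fun i => (hε.measurable i).aemeasurable)
    (f := fun i : B => φ i) (fun i => (measurable_of_countable _).aestronglyMeasurable)
  simp only [hε.integral_comp] at h
  rw [Finset.prod_coe_sort B (fun i => (φ i 1 + φ i (-1)) / 2)] at h
  rw [← h]
  exact integral_congr_ae (ae_of_all _ fun ω => (B.prod_coe_sort fun i => φ i (ε i ω)).symm)

lemma integrable_prod_comp (φ : ι → ℤ → ℝ) (B : Finset ι) :
    Integrable (fun ω => ∏ i ∈ B, φ i (ε i ω)) μ := by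
  refine Integrable.of_bound (Finset.measurable_fun_prod B fun i _ =>
    (measurable_of_countable (φ i)).comp (hε.measurable i)).aestronglyMeasurable
    (∏ i ∈ B, max ‖φ i 1‖ ‖φ i (-1)‖) ?_
  filter_upwards [B.eventually_all.2 fun i _ => hε.ae_eq_one_or_eq_neg_one i] with ω hω
  rw [norm_prod]
  refine Finset.prod_le_prod (fun _ _ => norm_nonneg _) fun i hi => ?_
  rcases hω i hi with h | h <;> simp [h]

section Tail

variable (a : ι → ℝ) (B : Finset ι)

lemma mgf_sum_mul (θ : ℝ) :
    mgf (fun ω => ∑ i ∈ B, a i * ε i ω) μ θ = ∏ i ∈ B, Real.cosh (θ * a i) := by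
  have h := hε.integral_prod_comp (fun i n => Real.exp (θ * (a i * n))) B
  simp only [← Real.exp_sum, ← Finset.mul_sum] at h
  refine h.trans (Finset.prod_congr rfl fun i _ => ?_)
  rw [Real.cosh_eq]
  push_cast
  ring_nf

lemma integrable_exp_mul_sum_mul (θ : ℝ) :
    Integrable (fun ω => Real.exp (θ * ∑ i ∈ B, a i * ε i ω)) μ := by
  simpa only [← Real.exp_sum, ← Finset.mul_sum] using
    hε.integrable_prod_comp (fun i n => Real.exp (θ * (a i * n))) B

lemma mgf_sum_mul_le (θ : ℝ) :
    mgf (fun ω => ∑ i ∈ B, a i * ε i ω) μ θ ≤ Real.exp (θ ^ 2 / 2 * ∑ i ∈ B, a i ^ 2) := by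
  rw [hε.mgf_sum_mul, Finset.mul_sum, Real.exp_sum]
  refine Finset.prod_le_prod (fun i _ => (Real.cosh_pos _).le) fun i _ => ?_
  refine (Real.cosh_le_exp_half_sq _).trans_eq ?_
  ring_nf

end Tail

end IsRademacherFamily

lemma one_add_sq_div_two_le_cosh (x : ℝ) : 1 + x ^ 2 / 2 ≤ Real.cosh x := by
  have hcosh : Real.cosh x = 1 + 2 * Real.sinh (|x| / 2) ^ 2 := by
    rw [← Real.cosh_abs, ← mul_div_cancel₀ |x| two_ne_zero, mul_div_assoc, Real.cosh_two_mul,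
      Real.cosh_sq]
    ring_nf
  have hsinh : (|x| / 2) ^ 2 ≤ Real.sinh (|x| / 2) ^ 2 :=
    pow_le_pow_left₀ (by positivity) (Real.self_le_sinh_iff.2 (by positivity)) 2
  rw [div_pow, sq_abs] at hsinh
  linarith

lemma exp_four_mul_sq_le_cosh {a : ℝ} (ha : |a| ≤ 1 / 6) :
    Real.exp (4 * a ^ 2) ≤ Real.cosh (3 * a) := by
  have hsq : a ^ 2 ≤ 1 / 36 := by nlinarith [abs_le.1 ha]
  have hexp := (abs_le.1 (Real.abs_exp_sub_one_sub_id_le (x := 4 * a ^ 2)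
    (abs_le.2 ⟨by linarith [sq_nonneg a], by linarith⟩))).2
  have hcosh := one_add_sq_div_two_le_cosh (3 * a)
  nlinarith [sq_nonneg a]

lemma IsRademacherFamily.exp_four_mul_le_mgf_three {ε : ι → Ω → ℤ} (hε : IsRademacherFamily μ ε)
    {a : ι → ℝ} {B : Finset ι} (ha : ∀ i ∈ B, |a i| ≤ 1 / 6) :
    Real.exp (4 * ∑ i ∈ B, a i ^ 2) ≤ mgf (fun ω => ∑ i ∈ B, a i * ε i ω) μ 3 := by
  rw [hε.mgf_sum_mul, Finset.mul_sum, Real.exp_sum]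
  exact Finset.prod_le_prod (fun i _ => (Real.exp_pos _).le) fun i hi =>
    exp_four_mul_sq_le_cosh (ha i hi)

lemma IsRademacherFamily.exp_div_four_le_measureReal {ε : ι → Ω → ℤ}
    (hε : IsRademacherFamily μ ε) {a : ι → ℝ} {B : Finset ι} (ha : ∀ i ∈ B, |a i| ≤ 1 / 6) {y : ℝ}
    (hy : y ≤ 2 * ∑ i ∈ B, a i ^ 2 - 1) :
    Real.exp (-10 * ∑ i ∈ B, a i ^ 2) / 4 ≤ μ.real {ω | y ≤ ∑ i ∈ B, a i * ε i ω} := by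
  have hmgf3 := hε.exp_four_mul_le_mgf_three ha
  have hmeas : Measurable fun ω => ∑ i ∈ B, a i * (ε i ω : ℝ) :=
    Finset.measurable_fun_sum B fun i _ =>
      ((measurable_of_countable _).comp (hε.measurable i)).const_mul _
  have hchernoff := mgf_le_exp_mul_mgf_add_sqrt hmeas (y := y) (by norm_num : (2 : ℝ) ≤ 3)
    (hε.integrable_exp_mul_sum_mul a B 2) (hε.integrable_exp_mul_sum_mul a B (2 * 3))
  set A := ∑ i ∈ B, a i ^ 2
  set P := μ.real {ω | y ≤ ∑ i ∈ B, a i * ε i ω}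
  -- Tilting: the mean of `exp (3 X)` is so much larger than that of `exp (2 X)` that values
  -- `X < y` account for at most half of it, and the mean of `exp (6 X)` controls the rest.
  have hmain : Real.exp ((3 - 2) * y) * mgf (fun ω => ∑ i ∈ B, a i * ε i ω) μ 2 ≤
      Real.exp (4 * A) / 2 := by
    calc Real.exp ((3 - 2) * y) * mgf (fun ω => ∑ i ∈ B, a i * ε i ω) μ 2
        ≤ Real.exp (2 * A - 1) * Real.exp (2 ^ 2 / 2 * A) :=
          mul_le_mul (Real.exp_le_exp.2 (by linarith)) (hε.mgf_sum_mul_le a B 2) mgf_nonneg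
            (Real.exp_pos _).le
      _ = Real.exp (4 * A) / Real.exp 1 := by
          rw [← Real.exp_add, ← Real.exp_sub]
          ring_nf
      _ ≤ Real.exp (4 * A) / 2 :=
          div_le_div_of_nonneg_left (Real.exp_pos _).le two_pos
            (by linarith [Real.add_one_le_exp (1 : ℝ)])
  have hsqrt : Real.exp (4 * A) / 2 ≤ √(Real.exp (18 * A) * P) := by
    have hmgf6 : mgf (fun ω => ∑ i ∈ B, a i * ε i ω) μ (2 * 3) ≤ Real.exp (18 * A) := by
      have h := hε.mgf_sum_mul_le a B (2 * 3)
      rwa [show (2 * 3 : ℝ) ^ 2 / 2 = 18 by norm_num] at h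
    have hmono : √(mgf (fun ω => ∑ i ∈ B, a i * ε i ω) μ (2 * 3) * P) ≤
        √(Real.exp (18 * A) * P) :=
      Real.sqrt_le_sqrt (mul_le_mul_of_nonneg_right hmgf6 measureReal_nonneg)
    linarith [(hmgf3.trans hchernoff).trans (add_le_add hmain hmono)]
  have hsq := (Real.le_sqrt' (by positivity)).1 hsqrt
  have hfour : (Real.exp (4 * A) / 2) ^ 2 = Real.exp (18 * A) * (Real.exp (-10 * A) / 4) := by
    rw [div_pow, ← Real.exp_nat_mul, mul_div_assoc', ← Real.exp_add]
    ring_nf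
  rw [hfour] at hsq
  exact le_of_mul_le_mul_left hsq (Real.exp_pos _)

end Rademacher

/-- The coefficients have variance `log (1 / l) + O(1)`, and the drift is half of that: this leaves
room for the term `log (1 / l)` below `2 * variance`, since `1 + 1 / 2 < 2`. -/
lemma exists_log_add_sum_logRatioDrift_le (K : ℝ) (hK : 0 < K) :
    ∃ l : ℝ, 0 < l ∧ l < 1 ∧ ∃ V : ℝ, ∀ B₀ : Finset Nat.Primes, (∀ p ∉ B₀, 100 ≤ (p : ℕ)) →
      ∀ᶠ s in 𝓝[>] (0 : ℝ), ∀ᶠ B in atTop,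
        Real.log (K / l) + ∑ p ∈ B \ B₀, logRatioDrift s (l * s) p ≤
          2 * ∑ p ∈ B \ B₀, logRatioCoeff s (l * s) p ^ 2 - 1 ∧
        ∑ p ∈ B \ B₀, logRatioCoeff s (l * s) p ^ 2 ≤ V := by
  obtain ⟨C, hC⟩ := exists_sum_primes_sdiff_bounds
  set L := max 1 (4 * (Real.log K + 3 * |C| + 1))
  have hL : 0 < L := zero_lt_one.trans_le (le_max_left _ _)
  refine ⟨Real.exp (-L), Real.exp_pos _, by simpa using hL, 5 / 4 * (L + C), fun B₀ hB₀ => ?_⟩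
  have hl1 : Real.exp (-L) < 1 := by simpa using hL
  filter_upwards [hC _ (Real.exp_pos (-L)) hl1 B₀, self_mem_nhdsWithin] with s hs hs0
  have hls : 0 ≤ Real.exp (-L) * s := mul_nonneg (Real.exp_pos _).le (Set.mem_Ioi.1 hs0).le
  have hlss : Real.exp (-L) * s ≤ s := mul_le_of_le_one_left (Set.mem_Ioi.1 hs0).le hl1.le
  filter_upwards [hs] with B hB
  rw [Real.log_exp] at hB
  have hlarge {p : Nat.Primes} (hp : p ∈ B \ B₀) : 100 ≤ (p : ℕ) :=
    hB₀ p (Finset.mem_sdiff.1 hp).2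
  have hvar_le := Finset.sum_le_sum fun p hp =>
    (sq_logRatioCoeff_mem_Icc hls hlss (hlarge hp)).2
  have hle_var := Finset.sum_le_sum fun p hp =>
    (sq_logRatioCoeff_mem_Icc hls hlss (hlarge hp)).1
  have hdrift := Finset.sum_le_sum fun p hp => logRatioDrift_le hls hlss (hlarge hp)
  rw [← Finset.mul_sum] at hvar_le hle_var hdrift
  have hdiff := abs_le.1 hB.1
  refine ⟨?_, by linarith⟩
  rw [Real.log_div hK.ne' (Real.exp_pos _).ne', Real.log_exp]
  have hLK : 4 * (Real.log K + 3 * |C| + 1) ≤ L := le_max_right _ _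
  linarith [le_abs_self C, neg_abs_le C]

namespace IsRandomCompletelyMultiplicative

variable {Ω : Type*} [MeasurableSpace Ω] {μ : Measure Ω} {f : ℕ → Ω → ℤ}
  (hf : IsRandomCompletelyMultiplicative μ f)
include hf

lemma isRademacherFamily : IsRademacherFamily μ fun p : Nat.Primes => f p :=
  ⟨hf.measurable_prime, hf.prob_one, hf.prob_neg_one, hf.indep⟩

lemma ae_isSignMultiplicative [IsProbabilityMeasure μ] :
    ∀ᵐ ω ∂μ, IsSignMultiplicative fun n => f n ω := by
  filter_upwards [ae_all_iff.2 hf.isRademacherFamily.ae_eq_one_or_eq_neg_one] with ω hω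
  exact ⟨hf.map_one ω, hf.map_mul ω, hω⟩

lemma exists_le_prob_le_eulerProd_div [IsProbabilityMeasure μ] {K : ℝ} (hK : 0 < K) :
    ∃ l : ℝ, 0 < l ∧ l < 1 ∧ ∃ c > 0, ∀ B₀ : Finset Nat.Primes, (∀ p ∉ B₀, 100 ≤ (p : ℕ)) →
      ∀ᶠ s in 𝓝[>] (0 : ℝ), ∀ᶠ B in atTop, c ≤ μ.real {ω | K / l ≤
        eulerProd (fun n => f n ω) s (B \ B₀) / eulerProd (fun n => f n ω) (l * s) (B \ B₀)} := by
  obtain ⟨l, hl0, hl1, V, hV⟩ := exists_log_add_sum_logRatioDrift_le K hK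
  refine ⟨l, hl0, hl1, Real.exp (-10 * V) / 4, by positivity, fun B₀ hB₀ => ?_⟩
  filter_upwards [hV B₀ hB₀, self_mem_nhdsWithin] with s hs hs0
  have hs0 : 0 ≤ s := (Set.mem_Ioi.1 hs0).le
  have hls : 0 ≤ l * s := mul_nonneg hl0.le hs0
  filter_upwards [hs] with B hB
  have htail := hf.isRademacherFamily.exp_div_four_le_measureReal (B := B \ B₀)
    (fun p hp => abs_logRatioCoeff_le hls (mul_le_of_le_one_left hs0 hl1.le)
      (hB₀ p (Finset.mem_sdiff.1 hp).2)) hB.1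
  refine (div_le_div_of_nonneg_right (Real.exp_le_exp.2 (by linarith)) zero_le_four).trans
    (htail.trans (ENNReal.toReal_mono (measure_ne_top μ _) (measure_mono_ae ?_)))
  filter_upwards [hf.ae_isSignMultiplicative] with ω hω hle
  change _ ≤ eulerProd _ _ _ / _
  rw [hω.eulerProd_div_eulerProd_eq_exp hs0 hls, ← Real.log_le_iff_le_exp (by positivity)]
  exact le_sub_iff_add_le.2 hle

end IsRandomCompletelyMultiplicative

section SquarePairs

/-- The pairs of positive integers whose product is a square: the pairs at which the values of a
random completely multiplicative function are correlated. -/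
def squarePairs : Set (ℕ × ℕ) := {x | 0 < x.1 * x.2 ∧ IsSquare (x.1 * x.2)}

lemma exists_eq_mul_sq_of_isSquare_mul {m n : ℕ} (hm : 0 < m) (h : IsSquare (m * n)) :
    ∃ d u v : ℕ, m = d * u ^ 2 ∧ n = d * v ^ 2 := by
  obtain ⟨r, hr⟩ := h
  obtain ⟨g, a, b, hg, hab, rfl, rfl⟩ := Nat.exists_coprime' (m := m) (n := n)
    (Nat.gcd_pos_of_pos_left n hm)
  obtain ⟨k, rfl⟩ : g ∣ r :=
    (Nat.pow_dvd_pow_iff two_ne_zero).1 ⟨a * b, by rw [sq r, ← hr]; ring⟩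
  have hk : a * b = k ^ 2 :=
    Nat.eq_of_mul_eq_mul_left (pow_pos hg 2) (by linarith)
  obtain ⟨u, hu⟩ := exists_eq_pow_of_mul_eq_pow (Nat.isUnit_iff.2 hab) hk
  obtain ⟨v, hv⟩ := exists_eq_pow_of_mul_eq_pow (Nat.isUnit_iff.2 hab.symm)
    ((mul_comm b a).trans hk)
  exact ⟨g, u, v, by rw [hu, mul_comm], by rw [hv, mul_comm]⟩

lemma dirichletWeight_mul_sq (s : ℝ) (d u : ℕ) :
    dirichletWeight s (d * u ^ 2) = dirichletWeight s d * (u : ℝ) ^ (-(1 + 2 * s)) := by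
  rw [dirichletWeight, dirichletWeight, Nat.cast_mul, Nat.cast_pow,
    Real.mul_rpow d.cast_nonneg (by positivity), ← Real.rpow_natCast, ← Real.rpow_mul u.cast_nonneg]
  push_cast
  ring_nf

lemma summable_squarePairs {s : ℝ} (hs : 0 < s) :
    Summable (squarePairs.indicator fun x => dirichletWeight s x.1 * dirichletWeight s x.2) := by
  rw [← summable_subtype_iff_indicator]
  have hparam (x : squarePairs) : ∃ y : ℕ × ℕ × ℕ, x.1 = (y.1 * y.2.1 ^ 2, y.1 * y.2.2 ^ 2) := by
    obtain ⟨d, u, v, hu, hv⟩ :=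
      exists_eq_mul_sq_of_isSquare_mul (Nat.pos_of_mul_pos_right x.2.1) x.2.2
    exact ⟨(d, u, v), Prod.ext hu hv⟩
  choose φ hφ using hparam
  have hinj : Function.Injective φ := fun x y h => Subtype.ext (by rw [hφ x, hφ y, h])
  have hsum : Summable fun n : ℕ => (n : ℝ) ^ (-(1 + 2 * s)) :=
    Real.summable_nat_rpow.2 (by linarith)
  have h0 : (0 : ℕ → ℝ) ≤ fun n : ℕ => (n : ℝ) ^ (-(1 + 2 * s)) := fun n =>
    Real.rpow_nonneg n.cast_nonneg _
  refine ((hsum.mul_of_nonneg (hsum.mul_of_nonneg hsum h0 h0) h0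
    fun x => mul_nonneg (h0 _) (h0 _)).comp_injective hinj).congr fun x => ?_
  have hx : 0 < (φ x).1 := by
    have hpos := x.2.1
    rw [hφ x] at hpos
    exact Nat.pos_of_mul_pos_right (Nat.pos_of_mul_pos_right hpos)
  have hd := dirichletWeight_mul_dirichletWeight hx s s
  rw [← two_mul] at hd
  rw [Function.comp_apply, Function.comp_apply, hφ x, dirichletWeight_mul_sq,
    dirichletWeight_mul_sq, ← hd]
  ring

end SquarePairs

namespace IsSignMultiplicative

variable {a : ℕ → ℤ} (ha : IsSignMultiplicative a)
include ha

lemma map_prod_primes (B : Finset Nat.Primes) : a (∏ p ∈ B, (p : ℕ)) = ∏ p ∈ B, a p := by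
  induction B using Finset.cons_induction with
  | empty => exact ha.map_one
  | cons p B hp ih =>
    rw [Finset.prod_cons, Finset.prod_cons, ← ih,
      ha.map_mul _ _ p.2.pos (Finset.prod_pos fun q _ => q.2.pos)]

lemma map_sq_mul {m n : ℕ} (hm : 0 < m) (hn : 0 < n) : a (m ^ 2 * n) = a n := by
  rw [sq, ha.map_mul _ _ (mul_pos hm hm) hn, ha.map_mul _ _ hm hm]
  rcases ha.eq_one_or_eq_neg_one hm with h | h <;> simp [h]

lemma abs_cast_mul_of_map_zero {w : ℕ → ℝ} (h0 : w 0 = 0) (n : ℕ) : |a n * w n| = |w n| := by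
  rcases n.eq_zero_or_pos with rfl | hn
  · rw [h0, mul_zero]
  · rw [abs_mul, ha.abs_eq_one hn, one_mul]

end IsSignMultiplicative

lemma measurable_of_measurable_primes {Ω : Type*} [MeasurableSpace Ω] {f : ℕ → Ω → ℤ}
    (hone : ∀ ω, f 1 ω = 1) (hmul : ∀ ω, ∀ m n : ℕ, 0 < m → 0 < n → f (m * n) ω = f m ω * f n ω)
    (hprime : ∀ p : Nat.Primes, Measurable (f p)) {n : ℕ} (hn : 0 < n) : Measurable (f n) := by
  induction n using Nat.recOnMul with
  | zero => omega
  | one => exact (funext hone : f 1 = fun _ => 1) ▸ measurable_const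
  | prime p hp => exact hprime ⟨p, hp⟩
  | mul a b iha ihb =>
    have ha : 0 < a := Nat.pos_of_mul_pos_right hn
    have hb : 0 < b := Nat.pos_of_mul_pos_left hn
    rw [(funext fun ω => hmul ω a b ha hb : f (a * b) = fun ω => f a ω * f b ω)]
    exact (iha ha).mul (ihb hb)

namespace IsRandomCompletelyMultiplicative

variable {Ω : Type*} [MeasurableSpace Ω] {μ : Measure Ω} {f : ℕ → Ω → ℤ}
  (hf : IsRandomCompletelyMultiplicative μ f)
include hf

lemma measurable {n : ℕ} (hn : 0 < n) : Measurable (f n) :=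
  measurable_of_measurable_primes hf.map_one hf.map_mul hf.measurable_prime hn

variable [IsProbabilityMeasure μ]

lemma integrable_cast {n : ℕ} (hn : 0 < n) : Integrable (fun ω => (f n ω : ℝ)) μ := by
  refine Integrable.of_bound ((measurable_of_countable _).comp
    (hf.measurable hn)).aestronglyMeasurable 1 ?_
  filter_upwards [hf.ae_isSignMultiplicative] with ω hω
  exact (hω.abs_eq_one hn).le

lemma integral_cast_of_isSquare {n : ℕ} (hn : 0 < n) (h : IsSquare n) :
    ∫ ω, (f n ω : ℝ) ∂μ = 1 := by
  obtain ⟨k, rfl⟩ := h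
  have hone : (fun ω => (f (k * k) ω : ℝ)) =ᵐ[μ] fun _ => 1 := by
    filter_upwards [hf.ae_isSignMultiplicative] with ω hω
    rw [← mul_one (k * k), ← sq, hω.map_sq_mul (Nat.pos_of_mul_pos_right hn) one_pos, hω.map_one,
      Int.cast_one]
  rw [integral_congr_ae hone, integral_const, probReal_univ, one_smul]

lemma integral_cast_of_not_isSquare {n : ℕ} (hn : 0 < n) (h : ¬IsSquare n) :
    ∫ ω, (f n ω : ℝ) ∂μ = 0 := by
  obtain ⟨r, k, hr, hk, rfl, hsq⟩ := Nat.sq_mul_squarefree_of_pos hn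
  set B := r.primeFactors.subtype Nat.Prime
  have hB : ∏ p ∈ B, (p : ℕ) = r :=
    (Finset.prod_subtype_of_mem _ fun p hp => Nat.prime_of_mem_primeFactors hp).trans
      (Nat.prod_primeFactors_of_squarefree hsq)
  have hprod : (fun ω => (f (k ^ 2 * r) ω : ℝ)) =ᵐ[μ] fun ω => ∏ p ∈ B, (f p ω : ℝ) := by
    filter_upwards [hf.ae_isSignMultiplicative] with ω hω
    rw [hω.map_sq_mul hk hr, ← Int.cast_prod]
    exact congrArg _ ((congrArg (f · ω) hB.symm).trans (hω.map_prod_primes B))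
  obtain ⟨p, hp⟩ : B.Nonempty := by
    refine Finset.nonempty_iff_ne_empty.2 fun hempty => h ?_
    rw [← hB, hempty, Finset.prod_empty, mul_one]
    exact IsSquare.sq k
  rw [integral_congr_ae hprod]
  exact (hf.isRademacherFamily.integral_prod_comp (fun _ v => (v : ℝ)) B).trans
    (Finset.prod_eq_zero hp (by norm_num))

lemma integrable_mul_mul {w : ℕ → ℝ} (h0 : w 0 = 0) (x : ℕ × ℕ) :
    Integrable (fun ω => f x.1 ω * w x.1 * (f x.2 ω * w x.2)) μ := by
  rcases Nat.eq_zero_or_pos (x.1 * x.2) with hx | hx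
  · rcases Nat.mul_eq_zero.1 hx with h | h <;> simp [h, h0]
  · have h1 : 0 < x.1 := Nat.pos_of_mul_pos_right hx
    have h2 : 0 < x.2 := Nat.pos_of_mul_pos_left hx
    refine ((hf.integrable_cast hx).mul_const (w x.1 * w x.2)).congr (ae_of_all _ fun ω => ?_)
    simp only [hf.map_mul ω _ _ h1 h2, Int.cast_mul]
    ring

lemma integral_mul_mul {w : ℕ → ℝ} (h0 : w 0 = 0) (x : ℕ × ℕ) :
    ∫ ω, f x.1 ω * w x.1 * (f x.2 ω * w x.2) ∂μ =
      squarePairs.indicator (fun x => w x.1 * w x.2) x := by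
  rcases Nat.eq_zero_or_pos (x.1 * x.2) with hx | hx
  · rw [Set.indicator_of_notMem fun h => hx.not_gt h.1]
    rcases Nat.mul_eq_zero.1 hx with h | h <;> simp [h, h0]
  have h1 : 0 < x.1 := Nat.pos_of_mul_pos_right hx
  have h2 : 0 < x.2 := Nat.pos_of_mul_pos_left hx
  have hmul (ω : Ω) : f x.1 ω * w x.1 * (f x.2 ω * w x.2) =
      f (x.1 * x.2) ω * (w x.1 * w x.2) := by
    rw [hf.map_mul ω _ _ h1 h2, Int.cast_mul]
    ring
  simp only [hmul, integral_mul_const]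
  by_cases hsq : IsSquare (x.1 * x.2)
  · rw [hf.integral_cast_of_isSquare hx hsq, one_mul,
      Set.indicator_of_mem (show x ∈ squarePairs from ⟨hx, hsq⟩)]
  · rw [hf.integral_cast_of_not_isSquare hx hsq, zero_mul,
      Set.indicator_of_notMem fun h => hsq h.2]

lemma integral_sq_eq_tsum_squarePairs {w : ℕ → ℝ} (h0 : w 0 = 0) (hw : Summable fun n => |w n|)
    {X : Ω → ℝ} (hX : ∀ᵐ ω ∂μ, HasSum (fun n => f n ω * w n) (X ω)) :
    ∫ ω, X ω ^ 2 ∂μ = ∑' x, squarePairs.indicator (fun x => w x.1 * w x.2) x := by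
  have hnorm : ∀ᵐ ω ∂μ, ∀ n, ‖f n ω * w n‖ = |w n| :=
    hf.ae_isSignMultiplicative.mono fun ω hω => hω.abs_cast_mul_of_map_zero h0
  have hsum : Summable fun x : ℕ × ℕ => ∫ ω, ‖f x.1 ω * w x.1 * (f x.2 ω * w x.2)‖ ∂μ := by
    refine (hw.mul_of_nonneg hw (fun _ => abs_nonneg _) fun _ => abs_nonneg _).congr fun x => ?_
    have hae : (fun ω => ‖f x.1 ω * w x.1 * (f x.2 ω * w x.2)‖) =ᵐ[μ]
        fun _ => |w x.1| * |w x.2| := by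
      filter_upwards [hnorm] with ω hω
      rw [norm_mul, hω, hω]
    rw [integral_congr_ae hae, integral_const, probReal_univ, one_smul]
  have hsq : (fun ω => X ω ^ 2) =ᵐ[μ]
      fun ω => ∑' x : ℕ × ℕ, f x.1 ω * w x.1 * (f x.2 ω * w x.2) := by
    filter_upwards [hnorm, hX] with ω hω hXω
    have habs : Summable fun n => ‖f n ω * w n‖ := hw.congr fun n => (hω n).symm
    rw [sq, ← hXω.tsum_eq, tsum_mul_tsum_of_summable_norm habs habs]
  rw [integral_congr_ae hsq,
    ← (hasSum_integral_of_summable_integral_norm (hf.integrable_mul_mul h0) hsum).tsum_eq]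
  simp only [hf.integral_mul_mul h0]

end IsRandomCompletelyMultiplicative

lemma tendsto_tsum_squarePairs_cutoffGap {s : ℝ} (hs : 0 < s) :
    Tendsto (fun x : Finset Nat.Primes × ℕ => ∑' y, squarePairs.indicator (fun y =>
      dirichletWeight s y.1 * cutoffGap s x.1 x.2 y.1 *
        (dirichletWeight s y.2 * cutoffGap s x.1 x.2 y.2)) y) (atTop ×ˢ atTop) (𝓝 0) := by
  rw [← tsum_zero (α := ℝ) (β := ℕ × ℕ)]
  refine tendsto_tsum_of_dominated_convergence (summable_squarePairs hs) (fun y => ?_)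
    (Eventually.of_forall fun x y => ?_)
  · by_cases hy : y ∈ squarePairs
    · have hlim {n : ℕ} (hn : 0 < n) :=
        (tendsto_cutoffGap hs hn).const_mul (dirichletWeight s n)
      simpa only [Set.indicator_of_mem hy, mul_zero] using
        (hlim (Nat.pos_of_mul_pos_right hy.1)).mul (hlim (Nat.pos_of_mul_pos_left hy.1))
    · simpa only [Set.indicator_of_notMem hy] using tendsto_const_nhds
  · rw [norm_indicator_eq_indicator_norm]
    refine Set.indicator_le_indicator ?_
    have hle (n : ℕ) : ‖dirichletWeight s n * cutoffGap s x.1 x.2 n‖ ≤ dirichletWeight s n := by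
      rw [norm_mul, Real.norm_of_nonneg (dirichletWeight_nonneg s n)]
      exact mul_le_of_le_one_right (dirichletWeight_nonneg s n)
        (abs_cutoffGap_le_one hs.le x.1 x.2 n)
    rw [norm_mul]
    exact mul_le_mul (hle _) (hle _) (norm_nonneg _) (dirichletWeight_nonneg s _)

lemma summable_abs_dirichletWeight_mul_cutoffGap {s : ℝ} (hs : 0 ≤ s) (B : Finset Nat.Primes)
    (N : ℕ) : Summable fun n => |dirichletWeight s n * cutoffGap s B N n| := by
  simpa only [Int.cast_one, one_mul] using
    (isSignMultiplicative_one.hasSum_cutoffGap hs B N).summable.abs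

lemma dirichletWeight_zero_mul {s : ℝ} (hs : 0 ≤ s) (g : ℕ → ℝ) :
    dirichletWeight s 0 * g 0 = 0 := by
  rw [dirichletWeight, Nat.cast_zero, Real.zero_rpow (by linarith), zero_mul]

lemma measurable_eulerProd {Ω : Type*} [MeasurableSpace Ω] {f : ℕ → Ω → ℤ}
    {B : Finset Nat.Primes} (hf : ∀ p ∈ B, Measurable (f p)) (s : ℝ) :
    Measurable fun ω => eulerProd (fun n => f n ω) s B :=
  Finset.measurable_fun_prod _ fun p hp =>
    (measurable_of_countable fun v : ℤ => (1 - v * dirichletWeight s p)⁻¹).comp (hf p hp)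

namespace IsRandomCompletelyMultiplicative

variable {Ω : Type*} [MeasurableSpace Ω] {μ : Measure Ω} {f : ℕ → Ω → ℤ}
  (hf : IsRandomCompletelyMultiplicative μ f)
include hf

lemma measurable_abelSum (s : ℝ) (N : ℕ) : Measurable fun ω => abelSum (fun n => f n ω) s N :=
  Finset.measurable_fun_sum _ fun _ hn =>
    ((measurable_of_countable _).comp (hf.measurable (Finset.mem_Icc.1 hn).1)).mul_const _

variable [IsProbabilityMeasure μ]

lemma integrable_sq_abelSum_sub_eulerProd {s : ℝ} (hs : 0 ≤ s) (B : Finset Nat.Primes) (N : ℕ) :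
    Integrable (fun ω =>
      (abelSum (fun n => f n ω) s N - eulerProd (fun n => f n ω) s B) ^ 2) μ := by
  have hmeas := (hf.measurable_abelSum s N).sub
    (measurable_eulerProd (B := B) (fun p _ => hf.measurable_prime p) s)
  refine Integrable.of_bound (hmeas.pow_const 2).aestronglyMeasurable
    ((∑' n, |dirichletWeight s n * cutoffGap s B N n|) ^ 2) ?_
  filter_upwards [hf.ae_isSignMultiplicative] with ω hω
  rw [norm_pow, ← (hω.hasSum_cutoffGap hs B N).tsum_eq]
  refine pow_le_pow_left₀ (norm_nonneg _) (tsum_of_norm_bounded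
    (summable_abs_dirichletWeight_mul_cutoffGap hs B N).hasSum fun n => ?_) 2
  exact (hω.abs_cast_mul_of_map_zero (w := fun n => dirichletWeight s n * cutoffGap s B N n)
    (dirichletWeight_zero_mul hs _) n).le

lemma tendsto_integral_sq_abelSum_sub_eulerProd {s : ℝ} (hs : 0 < s) :
    Tendsto (fun x : Finset Nat.Primes × ℕ => ∫ ω, (abelSum (fun n => f n ω) s x.2 -
      eulerProd (fun n => f n ω) s x.1) ^ 2 ∂μ) (atTop ×ˢ atTop) (𝓝 0) := by
  refine (tendsto_tsum_squarePairs_cutoffGap hs).congr fun x =>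
    (hf.integral_sq_eq_tsum_squarePairs (dirichletWeight_zero_mul hs.le _)
      (summable_abs_dirichletWeight_mul_cutoffGap hs.le x.1 x.2) ?_).symm
  exact hf.ae_isSignMultiplicative.mono fun ω hω => hω.hasSum_cutoffGap hs.le x.1 x.2

lemma eventually_measureReal_lt_abs_abelSum_sub_eulerProd_le {s : ℝ} (hs : 0 < s) {ε δ : ℝ}
    (hε : 0 < ε) (hδ : 0 < δ) :
    ∀ᶠ B in atTop, ∀ᶠ N in atTop,
      μ.real {ω | ε < |abelSum (fun n => f n ω) s N - eulerProd (fun n => f n ω) s B|} ≤ δ := by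
  filter_upwards [((hf.tendsto_integral_sq_abelSum_sub_eulerProd hs).eventually_lt_const
    (mul_pos (pow_pos hε 2) hδ)).curry] with B hB
  filter_upwards [hB] with N hN
  have hmarkov := (mul_meas_ge_le_integral_of_nonneg (ae_of_all μ fun ω => sq_nonneg _)
    (hf.integrable_sq_abelSum_sub_eulerProd hs.le B N) (ε ^ 2)).trans hN.le
  refine le_trans (measureReal_mono fun ω (hω : ε < |_|) => ?_)
    (le_of_mul_le_mul_left hmarkov (by positivity))
  exact sq_le_sq.2 ((abs_of_pos hε).trans_le hω.le)

lemma measureReal_eulerProd_lt_le {s : ℝ} (hs : 0 ≤ s) (B : Finset Nat.Primes) {η : ℝ}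
    (hη : 0 < η) : μ.real {ω | eulerProd (fun n => f n ω) s B < η} ≤ η := by
  set Y : Ω → ℝ := fun ω => ∏ p ∈ B, (1 - f p ω * dirichletWeight s p)
  have hY : ∀ᵐ ω ∂μ, 0 < Y ω := hf.ae_isSignMultiplicative.mono fun ω hω =>
    Finset.prod_pos fun p _ => hω.one_sub_mul_dirichletWeight_pos hs p
  have hmean : ∫ ω, Y ω ∂μ = 1 := by
    refine (hf.isRademacherFamily.integral_prod_comp
      (fun p v => 1 - v * dirichletWeight s p) B).trans (Finset.prod_eq_one fun p _ => ?_)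
    push_cast
    ring
  have hmarkov := mul_meas_ge_le_integral_of_nonneg (hY.mono fun ω h => h.le)
    (hf.isRademacherFamily.integrable_prod_comp (fun p v => 1 - v * dirichletWeight s p) B) η⁻¹
  rw [hmean, inv_mul_le_iff₀ hη, mul_one] at hmarkov
  refine le_trans (ENNReal.toReal_mono (measure_ne_top μ _) (measure_mono_ae ?_)) hmarkov
  filter_upwards [hY] with ω hω (h : eulerProd _ s B < η)
  rw [eulerProd, Finset.prod_inv_distrib] at h
  exact ((inv_lt_comm₀ hω hη).1 h).le

end IsRandomCompletelyMultiplicative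

section ZeroOneLaw

variable {Ω : Type*} {m₀ : MeasurableSpace Ω} {μ : Measure Ω} [IsFiniteMeasure μ] {G : Set Ω}
  {r : ℝ}

lemma condExp_indicator_le_of_forall_inter_le {m : MeasurableSpace Ω} (hm : m ≤ m₀)
    (hG : MeasurableSet[m₀] G)
    (h : ∀ H, MeasurableSet[m] H → μ.real (G ∩ H) ≤ r * μ.real H) :
    μ[G.indicator (1 : Ω → ℝ) | m] ≤ᵐ[μ] fun _ => r := by
  have hint : Integrable (G.indicator (1 : Ω → ℝ)) μ := (integrable_const 1).indicator hG
  refine ae_le_of_ae_le_trim (hm := hm) (ae_le_of_forall_setIntegral_le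
    (integrable_condExp.trim hm stronglyMeasurable_condExp) (integrable_const r) fun H hH _ => ?_)
  rw [← setIntegral_trim hm stronglyMeasurable_condExp hH, setIntegral_condExp hm hint hH,
    ← setIntegral_trim hm stronglyMeasurable_const hH, integral_indicator_one hG, setIntegral_const,
    measureReal_restrict_apply hG, smul_eq_mul, mul_comm]
  exact h H hH

lemma measure_eq_zero_of_forall_inter_le {ℱ : Filtration ℕ m₀} (hG : MeasurableSet[⨆ n, ℱ n] G)
    (hr : r < 1) (h : ∀ n H, MeasurableSet[ℱ n] H → μ.real (G ∩ H) ≤ r * μ.real H) : μ G = 0 := by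
  have hle : ⨆ n, ℱ n ≤ m₀ := iSup_le ℱ.le
  have hint : Integrable (G.indicator (1 : Ω → ℝ)) μ := (integrable_const 1).indicator (hle G hG)
  have hbound : ∀ᵐ ω ∂μ, ∀ n, (μ[G.indicator (1 : Ω → ℝ) | ℱ n]) ω ≤ r :=
    ae_all_iff.2 fun n => condExp_indicator_le_of_forall_inter_le (ℱ.le n) (hle G hG) (h n)
  refine measure_eq_zero_iff_ae_notMem.2 ?_
  filter_upwards [hbound, tendsto_ae_condExp (ℱ := ℱ) (G.indicator (1 : Ω → ℝ))] with ω hω hlim hωG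
  rw [condExp_of_stronglyMeasurable hle (stronglyMeasurable_one.indicator hG) hint,
    Set.indicator_of_mem hωG] at hlim
  exact hr.not_ge (le_of_tendsto' hlim hω)

end ZeroOneLaw

/-- The σ-algebra generated by the values of `f` at the primes in `T`. -/
@[reducible] def primeSigmaAlgebra {Ω : Type*} (f : ℕ → Ω → ℤ) (T : Set Nat.Primes) :
    MeasurableSpace Ω :=
  ⨆ p ∈ T, MeasurableSpace.comap (f p) ⊤

section PrimeSigmaAlgebra

variable {Ω : Type*} {f : ℕ → Ω → ℤ}

lemma measurable_primeSigmaAlgebra {T : Set Nat.Primes} {p : Nat.Primes} (hp : p ∈ T) :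
    Measurable[primeSigmaAlgebra f T] (f p) :=
  (comap_measurable (f p)).mono (le_iSup₂_of_le p hp le_rfl) le_rfl

lemma primeSigmaAlgebra_mono {T T' : Set Nat.Primes} (h : T ⊆ T') :
    primeSigmaAlgebra f T ≤ primeSigmaAlgebra f T' :=
  biSup_mono h

end PrimeSigmaAlgebra

lemma measurableSet_hasConstantSignFrom_partialSum {Ω : Type*} [MeasurableSpace Ω]
    {f : ℕ → Ω → ℤ} (hf : ∀ n, 0 < n → Measurable (f n)) (m : ℕ) :
    MeasurableSet {ω | HasConstantSignFrom (fun k : ℕ => partialSum (fun n => f n ω) k) m} := by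
  have hsum (x : ℝ) : Measurable fun ω => partialSum (fun n => f n ω) x :=
    Finset.measurable_fun_sum _ fun n hn =>
      ((measurable_of_countable _).comp (hf n (Finset.mem_Icc.1 hn).1)).div_const _
  unfold HasConstantSignFrom
  measurability

namespace IsRandomCompletelyMultiplicative

variable {Ω : Type*} [mΩ : MeasurableSpace Ω] {μ : Measure Ω} {f : ℕ → Ω → ℤ}
  (hf : IsRandomCompletelyMultiplicative μ f)
include hf

lemma primeSigmaAlgebra_le (T : Set Nat.Primes) : primeSigmaAlgebra f T ≤ mΩ :=
  iSup₂_le fun p _ => (hf.measurable_prime p).comap_le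

lemma indep_primeSigmaAlgebra_compl (T : Set Nat.Primes) :
    Indep (primeSigmaAlgebra f T) (primeSigmaAlgebra f Tᶜ) μ :=
  indep_iSup_of_disjoint (fun p => (hf.measurable_prime p).comap_le) hf.indep disjoint_compl_right

/-- The filtration whose `n`-th σ-algebra is generated by the values of `f` at the primes below
`n`. -/
def primeFiltration : Filtration ℕ mΩ where
  seq n := primeSigmaAlgebra f {p | (p : ℕ) < n}
  mono' _ _ h := primeSigmaAlgebra_mono fun _ hp => lt_of_lt_of_le hp h
  le' _ := hf.primeSigmaAlgebra_le _

lemma measurable_iSup_primeFiltration {n : ℕ} (hn : 0 < n) :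
    Measurable[⨆ k, hf.primeFiltration k] (f n) := by
  refine @measurable_of_measurable_primes _ (⨆ k, hf.primeFiltration k) _ hf.map_one hf.map_mul
    (fun p => ?_) _ hn
  exact (measurable_primeSigmaAlgebra (Nat.lt_succ_self p)).mono
    (le_iSup (fun k => hf.primeFiltration k) (p + 1 : ℕ)) le_rfl

variable [IsProbabilityMeasure μ]

lemma prob_hasConstantSignFrom_inter_le {s l δ : ℝ} {m N : ℕ} {B₀ B : Finset Nat.Primes}
    (hs : 0 < s) (hl : 0 < l) (hl1 : l ≤ 1) (hB : B₀ ⊆ B)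
    (hhalf : ∀ a, IsSignMultiplicative a → 1 / 2 ≤ eulerProd a s B₀ / eulerProd a (l * s) B₀)
    (hsmall : μ.real {ω | eulerProd (fun n => f n ω) s B < (2 * m ^ 2 + 4) * s} ≤ δ)
    (herr : μ.real {ω | l * s <
      |abelSum (fun n => f n ω) s N - eulerProd (fun n => f n ω) s B|} ≤ δ)
    (herr' : μ.real {ω | l * s <
      |abelSum (fun n => f n ω) (l * s) N - eulerProd (fun n => f n ω) (l * s) B|} ≤ δ) :
    μ.real ({ω | HasConstantSignFrom (fun k : ℕ => partialSum (fun n => f n ω) k) m} ∩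
      {ω | 16 / l ≤ eulerProd (fun n => f n ω) s (B \ B₀) /
        eulerProd (fun n => f n ω) (l * s) (B \ B₀)}) ≤ 3 * δ := by
  set small := {ω | eulerProd (fun n => f n ω) s B < (2 * m ^ 2 + 4) * s}
  set far := {ω | l * s < |abelSum (fun n => f n ω) s N - eulerProd (fun n => f n ω) s B|}
  set far' := {ω | l * s <
    |abelSum (fun n => f n ω) (l * s) N - eulerProd (fun n => f n ω) (l * s) B|}
  refine (ENNReal.toReal_mono (measure_ne_top _ _)
    (measure_mono_ae (t := small ∪ (far ∪ far')) ?_)).trans ?_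
  · filter_upwards [hf.ae_isSignMultiplicative] with ω ha hω
    by_contra hgood
    obtain ⟨hlarge, hnear, hnear'⟩ : ω ∉ small ∧ ω ∉ far ∧ ω ∉ far' :=
      ⟨fun h => hgood (.inl h), fun h => hgood (.inr (.inl h)), fun h => hgood (.inr (.inr h))⟩
    have hratio := mul_le_eulerProd_div hB (by positivity) (by norm_num) hω.2 (hhalf _ ha)
    rw [show 16 / l * (1 / 2) = 8 / l by ring] at hratio
    exact ha.not_hasConstantSignFrom hs hl hl1 (not_lt.1 hlarge) hratio (not_lt.1 hnear)
      (not_lt.1 hnear') hω.1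
  · calc μ.real (small ∪ (far ∪ far'))
        ≤ μ.real small + (μ.real far + μ.real far') :=
          (measureReal_union_le _ _).trans (by gcongr; exact measureReal_union_le _ _)
      _ ≤ 3 * δ := by linarith

lemma exists_le_prob_and_prob_hasConstantSignFrom_inter_le :
    ∃ c > 0, ∀ B₀ : Finset Nat.Primes, (∀ p ∉ B₀, 100 ≤ (p : ℕ)) → ∀ m : ℕ, ∀ δ > 0,
      ∃ V, MeasurableSet[primeSigmaAlgebra f (B₀ : Set Nat.Primes)ᶜ] V ∧ c ≤ μ.real V ∧
        μ.real ({ω | HasConstantSignFrom (fun k : ℕ => partialSum (fun n => f n ω) k) m} ∩ V)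
          ≤ δ := by
  obtain ⟨l, hl0, hl1, c, hc, hprob⟩ := hf.exists_le_prob_le_eulerProd_div (K := 16) (by norm_num)
  refine ⟨c, hc, fun B₀ hB₀ m δ hδ => ?_⟩
  obtain ⟨s, hprob, hhalf, hsδ, hs⟩ := ((hprob B₀ hB₀).and
    ((eventually_half_le_eulerProd_div B₀ hl0 hl1.le).and
    (((tendsto_const_mul_nhdsGT_zero (k := 2 * (m : ℝ) ^ 2 + 4) (by positivity)).eventually
      (Ioc_mem_nhdsGT (show 0 < δ / 3 by positivity))).and self_mem_nhdsWithin))).exists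
  have hls : 0 < l * s := mul_pos hl0 hs
  have hδ3 : 0 < δ / 3 := by positivity
  obtain ⟨B, hprob, herr, herr', hB⟩ := (hprob.and
    ((hf.eventually_measureReal_lt_abs_abelSum_sub_eulerProd_le hs hls hδ3).and
    ((hf.eventually_measureReal_lt_abs_abelSum_sub_eulerProd_le hls hls hδ3).and
    (eventually_ge_atTop B₀)))).exists
  obtain ⟨N, herr, herr'⟩ := (herr.and herr').exists
  have hsmall := (hf.measureReal_eulerProd_lt_le hs.le B hsδ.1).trans hsδ.2
  have hmeas (t : ℝ) : Measurable[primeSigmaAlgebra f (B₀ : Set Nat.Primes)ᶜ] fun ω =>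
      eulerProd (fun n => f n ω) t (B \ B₀) :=
    @measurable_eulerProd _ (_) _ _
      (fun _ hp => measurable_primeSigmaAlgebra (Finset.mem_sdiff.1 hp).2) t
  refine ⟨_, measurableSet_le (mδ := primeSigmaAlgebra f (B₀ : Set Nat.Primes)ᶜ) measurable_const
    ((hmeas s).div (hmeas (l * s))), hprob, ?_⟩
  exact (hf.prob_hasConstantSignFrom_inter_le hs hl0 hl1.le hB hhalf hsmall herr herr').trans_eq
    (by ring)

lemma exists_prob_hasConstantSignFrom_inter_le :
    ∃ r < 1, ∀ m n H, MeasurableSet[hf.primeFiltration n] H →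
      μ.real ({ω | HasConstantSignFrom (fun k : ℕ => partialSum (fun n => f n ω) k) m} ∩ H) ≤
        r * μ.real H := by
  obtain ⟨c, hc, hV⟩ := hf.exists_le_prob_and_prob_hasConstantSignFrom_inter_le
  refine ⟨1 - c, sub_lt_self 1 hc, fun m n H hH => le_of_forall_pos_le_add fun δ hδ => ?_⟩
  let B₀ : Finset Nat.Primes := (Finset.range (max n 100)).subtype Nat.Prime
  have hB₀ (p : Nat.Primes) : p ∈ B₀ ↔ (p : ℕ) < max n 100 :=
    Finset.mem_subtype.trans Finset.mem_range
  obtain ⟨V, hVm, hcV, hGV⟩ := hV B₀ (fun p hp =>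
    (le_max_right n 100).trans (not_lt.1 (mt (hB₀ p).2 hp))) m δ hδ
  have hHm : MeasurableSet[primeSigmaAlgebra f (B₀ : Set Nat.Primes)] H :=
    primeSigmaAlgebra_mono (fun p hp => (hB₀ p).2 (lt_max_of_lt_left hp)) H hH
  have hindep : μ.real (H ∩ V) = μ.real H * μ.real V := by
    rw [measureReal_def, (Indep_iff _ _ μ).1 (hf.indep_primeSigmaAlgebra_compl B₀) H V hHm hVm,
      ENNReal.toReal_mul, measureReal_def, measureReal_def]
  have hdiff := measureReal_inter_add_sdiff (μ := μ) (s := H) (hf.primeSigmaAlgebra_le _ V hVm)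
  set G := {ω | HasConstantSignFrom (fun k : ℕ => partialSum (fun n => f n ω) k) m}
  calc μ.real (G ∩ H)
      ≤ μ.real (H \ V ∪ G ∩ V) := measureReal_mono fun ω hω => by
        by_cases hωV : ω ∈ V
        · exact Or.inr ⟨hω.1, hωV⟩
        · exact Or.inl ⟨hω.2, hωV⟩
    _ ≤ μ.real (H \ V) + μ.real (G ∩ V) := measureReal_union_le _ _
    _ ≤ (1 - c) * μ.real H + δ := by nlinarith [measureReal_nonneg (μ := μ) (s := H)]

end IsRandomCompletelyMultiplicative

theorem theorem1 {Ω : Type*} [MeasurableSpace Ω] (μ : Measure Ω) [IsProbabilityMeasure μ]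
    (f : ℕ → Ω → ℤ) (hf : IsRandomCompletelyMultiplicative μ f) :
    ∀ᵐ ω ∂μ, ChangesSignInfinitelyOften (partialSum fun n => f n ω) := by
  obtain ⟨r, hr, hinter⟩ := hf.exists_prob_hasConstantSignFrom_inter_le
  have hnull (m : ℕ) :
      μ {ω | HasConstantSignFrom (fun k : ℕ => partialSum (fun n => f n ω) k) m} = 0 :=
    measure_eq_zero_of_forall_inter_le (ℱ := hf.primeFiltration)
      (@measurableSet_hasConstantSignFrom_partialSum _ (_) _
        (fun _ => hf.measurable_iSup_primeFiltration) m) hr (hinter m)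
  have hsign : ∀ᵐ ω ∂μ, ∀ m, ¬HasConstantSignFrom (fun k : ℕ => partialSum (fun n => f n ω) k) m :=
    ae_all_iff.2 fun m => measure_eq_zero_iff_ae_notMem.1 (hnull m)
  filter_upwards [hsign] with ω hω
  by_contra hchange
  obtain ⟨m, hm⟩ := exists_hasConstantSignFrom_of_not_changesSignInfinitelyOften hchange
  exact hω m hm
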